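/- Let $d\ge 4$, and let $\mathcal D^2$ be the Laplacian on the round unit sphere $S^{d-2}$. On $d$-dimensional Minkowski spacetime with retarded time $u=t-r$ and angles $x\in S^{d-2}$, consider formal $1/r$ expansions with smooth coefficients on $\mathbb R\times S^{d-2}$: a source $S\sim\sum_{n\ge d-2} r^{-n}S^{(n)}(u,x)$ ($n$ integer), and a scalar field $$\phi\sim\sum_{n\ge d/2-1} r^{-n}\phi^{(n)}(u,x)\quad (d \text{ even}),\qquad \phi\sim\sum_{n\ge d/2-1} r^{-n}\phi^{(n)}(u,x)+\sum_{p\ge d-3} r^{-p}\tilde\phi^{(p)}(u,x)\quad (d\text{ odd}),$$ where $n$ runs in integer steps upward from $d/2-1$ (so over integers for $d$ even and half-integers for $d$ odd), $p$ runs over integers, and coefficients at orders not occurring in a sum are zero. If $d=4$, assume $S^{(2)}=0$. Fix $u_0\in\mathbb R$. The equation $\Box\phi=S$ gives the recursion relations $$[\mathcal D^2+(n-1)(n-d+2)]\phi^{(n-1)}+(2n-d+2)\,\partial_u\phi^{(n)}=\sigma^{(n+1)},\qquad n\ge d/2-1,\tag{1}$$ with $\sigma^{(n+1)}=S^{(n+1)}$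 for $d$ even and $\sigma^{(n+1)}=0$ for $d$ odd, and, for $d$ odd, in addition $$[\mathcal D^2+(p-1)(p-d+2)]\tilde\phi^{(p-1)}+(2p-d+2)\,\partial_u\tilde\phi^{(p)}=S^{(p+1)},\qquad p\ge d-3.\tag{2}$$ (a) Let $d$ be even. For every integer $n$ with $1<n\le d-3$, the operator $\mathcal D^2+(n-1)(n-d+2)$ is a bijection of $C^\infty(S^{d-2})$ onto itself. For every smooth function $\phi_C(u,x)$ and all smooth functions $\phi_0^{(n)}(x)$, $n>d-3$, there is exactly one solution $(\phi^{(n)})$ of (1) with $\phi^{(d-3)}=\phi_C$ (Coulombic order) and $\phi^{(n)}(u_0,x)=\phi^{(n)}_0(x)$ for all $n>d-3$. (b) Let $d$ be odd. For every half-integer $n\in\mathbb Z+\tfrac12$, the operator $\mathcal D^2+(n-1)(n-d+2)$ is a bijection of $C^\infty(S^{d-2})$ onto itself. For every half-integer $n_0\ge d/2-1$, every smooth function $\psi(u,x)$, all smooth functions $\phi_0^{(n)}(x)$ for half-integers $n>n_0$, and all smooth functions $\tilde\phi_0^{(p)}(x)$ for integers $p\ge d-3$, there is exactly one solution $(\phi^{(n)}),(\tilde\phi^{(p)})$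 of (1) and (2) with $\phi^{(n_0)}=\psi$, $\phi^{(n)}(u_0,x)=\phi_0^{(n)}(x)$ for all $n>n_0$, and $\tilde\phi^{(p)}(u_0,x)=\tilde\phi_0^{(p)}(x)$ for all $p\ge d-3$. -/

import Mathlib

open scoped Manifold ContDiff

noncomputable section

/-- The unit `(d-2)`-sphere in `ℝ^{d-1}` (for `d ≥ 2` one has `d - 2 + 1 = d - 1`). -/
abbrev CelestialSphere (d : ℕ) : Type :=
  Metric.sphere (0 : EuclideanSpace ℝ (Fin (d - 2 + 1))) 1

/-- Smooth real functions `f(x)` on the unit `(d-2)`-sphere. -/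
abbrev SphereFunction (d : ℕ) : Type :=
  C^∞⟮𝓡 (d - 2), CelestialSphere d; 𝓘(ℝ, ℝ), ℝ⟯

/-- Smooth real functions `f(u, x)` of retarded time `u ∈ ℝ` and the angle `x ∈ S^{d-2}`. -/
abbrev ScriFunction (d : ℕ) : Type :=
  C^∞⟮(𝓘(ℝ, ℝ)).prod (𝓡 (d - 2)), ℝ × CelestialSphere d; 𝓘(ℝ, ℝ), ℝ⟯

open Classical in
/-- The extension of a function on the unit sphere to `ℝ^{d-1} ∖ {0}` that is constant along rays
(with value `0` at the origin). -/
def radialExtension {d : ℕ} (f : CelestialSphere d → ℝ)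
    (y : EuclideanSpace ℝ (Fin (d - 2 + 1))) : ℝ :=
  if hy : y = 0 then 0
  else f ⟨‖y‖⁻¹ • y, by
    rw [mem_sphere_zero_iff_norm, norm_smul, norm_inv, norm_norm,
      inv_mul_cancel₀ (norm_ne_zero_iff.mpr hy)]⟩

/-- The Laplacian `𝒟²` of the round unit `(d-2)`-sphere.
Since `Δ = ∂_r² + ((d-2)/r) ∂_r + r⁻² 𝒟²` on `ℝ^{d-1}`, it is the restriction to the sphere of
the Euclidean Laplacian of the extension that is constant along rays. -/
def sphereLaplacian {d : ℕ} (f : CelestialSphere d → ℝ) (x : CelestialSphere d) : ℝ :=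
  Laplacian.laplacian (radialExtension f) (x : EuclideanSpace ℝ (Fin (d - 2 + 1)))

/-- The angular operator `𝒟² + (n-1)(n-d+2)`. -/
def angularOperator (d : ℕ) (n : ℚ) (f : CelestialSphere d → ℝ) (x : CelestialSphere d) : ℝ :=
  sphereLaplacian f x + (((n - 1) * (n - d + 2) : ℚ) : ℝ) * f x

/-- `𝒟² + (n-1)(n-d+2)` is invertible as an operator on smooth functions on the sphere. -/
def AngularOperatorInvertible (d : ℕ) (n : ℚ) : Prop :=
  ∀ g : SphereFunction d, ∃! f : SphereFunction d, ∀ x, angularOperator d n f x = g x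

/-- The orders `n = d/2 - 1, d/2, d/2 + 1, …`, starting at radiative order
(integers for even `d`, half-integers for odd `d`). -/
def radiativeOrders (d : ℕ) : Set ℚ := {n | ∃ j : ℕ, n = (d : ℚ) / 2 - 1 + j}

/-- The integer orders `p = d - 3, d - 2, …`, starting at Coulombic order. -/
def coulombicOrders (d : ℕ) : Set ℚ := {p | ∃ j : ℕ, p = (d : ℚ) - 3 + j}

/-- The integer orders `n = d - 2, d - 1, …` of the source. -/
def sourceOrders (d : ℕ) : Set ℚ := {n | ∃ j : ℕ, n = (d : ℚ) - 2 + j}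

/-- The coefficient family `a` is that of a formal expansion `∑_{n ∈ N} a⁽ⁿ⁾(u, x) / rⁿ`:
the coefficients at all orders outside `N` vanish. -/
def IsExpansion {d : ℕ} (N : Set ℚ) (a : ℚ → ScriFunction d) : Prop :=
  ∀ n, n ∉ N → a n = 0

/-- The recursion relation at order `n`:
`[𝒟² + (n-1)(n-d+2)] φ⁽ⁿ⁻¹⁾ + (2n-d+2) ∂_u φ⁽ⁿ⁾ = S⁽ⁿ⁺¹⁾`. -/
def RecursionAt {d : ℕ} (φ S : ℚ → ScriFunction d) (n : ℚ) : Prop :=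
  ∀ (u : ℝ) (x : CelestialSphere d),
    angularOperator d n (fun y => φ (n - 1) (u, y)) x
      + ((2 * n - d + 2 : ℚ) : ℝ) * deriv (fun v : ℝ => φ n (v, x)) u = S (n + 1) (u, x)

end

open scoped Manifold ContDiff
open Laplacian MeasureTheory

/-! Let `M = d - 1` be the dimension of the space containing the sphere. The Euclidean Laplacian
sends functions homogeneous of degree `α` to functions homogeneous of degree `α - 2`, and read on
the sphere it is `𝒟² + α (α + d - 3)`. This is the angular operator at order `n` when `α = 1 - n`,
and equally when `α = n - d + 2`. Inverting the angular operator therefore amounts to solving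
Poisson's equation uniquely among homogeneous functions on the punctured space, and no spectral
theory of the sphere is needed.

For `2 - M < α < 0` uniqueness is a maximum principle (`harmonicUnique_of_neg`) and the Newtonian
potential converges and gives existence (`poissonSolvable_of_neg`). With `α = 1 - n` this covers `1
< n < d - 2`. Half-integer orders outside this range are reached by raising the degree in unit steps
(`HarmonicUnique.succ`, `PoissonSolvable.succ`). Each step divides by `α`, which is never zero at a
half-integer. Retarded time is carried along as a parameter throughout, so that the inverse of the
angular operator preserves joint smoothness in `(u, x)`.

The recursion then splits into two-term steps. The factor `2n - d + 2` is nonzero above radiative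
order, so integration in `u` gives the higher coefficient from the lower one and its initial value
(`existsUnique_next`). Inverting the angular operator gives the lower coefficient from the higher
one (`AngularSolvable.existsUnique_prev`). One prescribed coefficient thus determines everything
below it and, with initial data, everything above it (`existsUnique_sequence`). At radiative order
itself the left side vanishes identically, and what remains is the compatibility condition that the
source vanish at order `d/2`. -/

lemma two_le_smooth : (2 : WithTop ℕ∞) ≤ ∞ := by
  have : ((2 : ℕ∞) : WithTop ℕ∞) ≤ ((⊤ : ℕ∞) : WithTop ℕ∞) := WithTop.coe_le_coe.mpr le_top
  exact this

/-! ### Directional derivatives and sums of second derivatives. -/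

section Calculus

variable {V : Type*} [NormedAddCommGroup V] [NormedSpace ℝ V]

/-- The derivative of `F` in the constant direction `v`, as a function of the base point. -/
noncomputable def dirDeriv (v : V) (F : V → ℝ) : V → ℝ := fun p => fderiv ℝ F p v

/-- The second-order operator `∑ᵢ ∂_{eᵢ}²`. -/
noncomputable def sumSq {ι : Type*} [Fintype ι] (e : ι → V) (F : V → ℝ) : V → ℝ :=
  fun p => ∑ i, dirDeriv (e i) (dirDeriv (e i) F) p

variable {U : Set V} {F G : V → ℝ} {p : V}

lemma ContDiffOn.differentiableAt_of_isOpen (hF : ContDiffOn ℝ ∞ F U) (hU : IsOpen U)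
    (hp : p ∈ U) : DifferentiableAt ℝ F p :=
  (hF.contDiffAt (hU.mem_nhds hp)).differentiableAt (by simp)

lemma contDiffOn_dirDeriv (hF : ContDiffOn ℝ ∞ F U) (hU : IsOpen U) (v : V) :
    ContDiffOn ℝ ∞ (dirDeriv v F) U :=
  (hF.fderiv_of_isOpen hU (by simp)).clm_apply contDiffOn_const

lemma dirDeriv_congr (hU : IsOpen U) (h : Set.EqOn F G U) (v : V) :
    Set.EqOn (dirDeriv v F) (dirDeriv v G) U := fun p hp => by
  have : F =ᶠ[nhds p] G := Filter.eventuallyEq_of_mem (hU.mem_nhds hp) h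
  simp [dirDeriv, this.fderiv_eq]

lemma dirDeriv_mul (hF : DifferentiableAt ℝ F p) (hG : DifferentiableAt ℝ G p) (v : V) :
    dirDeriv v (fun q => F q * G q) p = F p * dirDeriv v G p + G p * dirDeriv v F p := by
  simp [dirDeriv, fderiv_fun_mul hF hG]

lemma dirDeriv_add (hF : DifferentiableAt ℝ F p) (hG : DifferentiableAt ℝ G p) (v : V) :
    dirDeriv v (fun q => F q + G q) p = dirDeriv v F p + dirDeriv v G p := by
  simp [dirDeriv, fderiv_fun_add hF hG]

lemma dirDeriv_const_mul (c : ℝ) (F : V → ℝ) (v : V) :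
    dirDeriv v (fun q => c * F q) p = c * dirDeriv v F p := by
  simp only [dirDeriv]
  change fderiv ℝ (c • F) p v = _
  rw [fderiv_const_smul_field]; rfl

lemma dirDeriv_sum {κ : Type*} (s : Finset κ) {H : κ → V → ℝ}
    (hH : ∀ k ∈ s, DifferentiableAt ℝ (H k) p) (v : V) :
    dirDeriv v (fun q => ∑ k ∈ s, H k q) p = ∑ k ∈ s, dirDeriv v (H k) p := by
  simp [dirDeriv, fderiv_fun_sum hH]

lemma dirDeriv_comm (hF : ContDiffOn ℝ ∞ F U) (hU : IsOpen U) (v w : V) (hp : p ∈ U) :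
    dirDeriv v (dirDeriv w F) p = dirDeriv w (dirDeriv v F) p := by
  have hd : DifferentiableAt ℝ (fderiv ℝ F) p :=
    ((hF.fderiv_of_isOpen (m := ∞) hU (by simp)).contDiffAt (hU.mem_nhds hp)).differentiableAt
      (by simp)
  have hs : IsSymmSndFDerivAt ℝ F p :=
    (hF.contDiffAt (hU.mem_nhds hp)).isSymmSndFDerivAt
      (by simpa using two_le_smooth)
  have key : ∀ a b : V, dirDeriv a (dirDeriv b F) p = fderiv ℝ (fderiv ℝ F) p a b := fun a b => by
    unfold dirDeriv
    rw [fderiv_clm_apply hd (differentiableAt_const _)]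
    simp
  rw [key, key, hs.eq]

section SumSq

variable {ι : Type*} [Fintype ι] (e : ι → V)

lemma contDiffOn_sumSq (hF : ContDiffOn ℝ ∞ F U) (hU : IsOpen U) :
    ContDiffOn ℝ ∞ (sumSq e F) U :=
  ContDiffOn.sum fun _ _ => contDiffOn_dirDeriv (contDiffOn_dirDeriv hF hU _) hU _

lemma sumSq_congr (hU : IsOpen U) (h : Set.EqOn F G U) :
    Set.EqOn (sumSq e F) (sumSq e G) U := fun p hp => by
  simp only [sumSq]
  exact Finset.sum_congr rfl fun i _ => dirDeriv_congr hU (dirDeriv_congr hU h _) _ hp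

lemma sumSq_add (hF : ContDiffOn ℝ ∞ F U) (hG : ContDiffOn ℝ ∞ G U) (hU : IsOpen U) (hp : p ∈ U) :
    sumSq e (fun q => F q + G q) p = sumSq e F p + sumSq e G p := by
  simp only [sumSq, ← Finset.sum_add_distrib]
  refine Finset.sum_congr rfl fun i _ => ?_
  rw [dirDeriv_congr hU (fun q hq => dirDeriv_add (hF.differentiableAt_of_isOpen hU hq)
    (hG.differentiableAt_of_isOpen hU hq) (e i)) _ hp]
  exact dirDeriv_add ((contDiffOn_dirDeriv hF hU _).differentiableAt_of_isOpen hU hp)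
    ((contDiffOn_dirDeriv hG hU _).differentiableAt_of_isOpen hU hp) _

lemma sumSq_const_mul (c : ℝ) (F : V → ℝ) :
    sumSq e (fun q => c * F q) p = c * sumSq e F p := by
  simp only [sumSq, Finset.mul_sum]
  refine Finset.sum_congr rfl fun i _ => ?_
  have : dirDeriv (e i) (fun q => c * F q) = fun q => c * dirDeriv (e i) F q :=
    funext fun q => dirDeriv_const_mul c F _
  rw [this, dirDeriv_const_mul]

lemma sumSq_sub (hF : ContDiffOn ℝ ∞ F U) (hG : ContDiffOn ℝ ∞ G U) (hU : IsOpen U) (hp : p ∈ U) :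
    sumSq e (fun q => F q - G q) p = sumSq e F p - sumSq e G p := by
  have h := sumSq_add e hF (contDiffOn_const (c := (-1 : ℝ)) |>.mul hG) hU hp
  rw [sumSq_const_mul] at h
  rw [sub_eq_add_neg, ← neg_one_mul, ← h]
  congr 1; ext q; ring

lemma sumSq_sum {κ : Type*} (s : Finset κ) {H : κ → V → ℝ}
    (hH : ∀ k ∈ s, ContDiffOn ℝ ∞ (H k) U) (hU : IsOpen U) (hp : p ∈ U) :
    sumSq e (fun q => ∑ k ∈ s, H k q) p = ∑ k ∈ s, sumSq e (H k) p := by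
  simp only [sumSq]
  rw [Finset.sum_comm]
  refine Finset.sum_congr rfl fun i _ => ?_
  rw [dirDeriv_congr hU (fun q hq => dirDeriv_sum s
    (fun k hk => (hH k hk).differentiableAt_of_isOpen hU hq) (e i)) _ hp]
  exact dirDeriv_sum s (fun k hk =>
    (contDiffOn_dirDeriv (hH k hk) hU _).differentiableAt_of_isOpen hU hp) _

lemma sumSq_mul (hF : ContDiffOn ℝ ∞ F U) (hG : ContDiffOn ℝ ∞ G U) (hU : IsOpen U) (hp : p ∈ U) :
    sumSq e (fun q => F q * G q) p = F p * sumSq e G p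
      + 2 * ∑ i, dirDeriv (e i) F p * dirDeriv (e i) G p + G p * sumSq e F p := by
  simp only [sumSq, Finset.mul_sum, ← Finset.sum_add_distrib]
  refine Finset.sum_congr rfl fun i _ => ?_
  have dF := hF.differentiableAt_of_isOpen hU hp
  have dG := hG.differentiableAt_of_isOpen hU hp
  have dF' := (contDiffOn_dirDeriv hF hU (e i)).differentiableAt_of_isOpen hU hp
  have dG' := (contDiffOn_dirDeriv hG hU (e i)).differentiableAt_of_isOpen hU hp
  rw [dirDeriv_congr hU (fun q hq => dirDeriv_mul (hF.differentiableAt_of_isOpen hU hq)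
    (hG.differentiableAt_of_isOpen hU hq) (e i)) _ hp,
    dirDeriv_add (F := fun q => F q * _) (G := fun q => G q * _) (dF.mul dG') (dG.mul dF'), dirDeriv_mul dF dG', dirDeriv_mul dG dF']
  ring

lemma sumSq_dirDeriv (hF : ContDiffOn ℝ ∞ F U) (hU : IsOpen U) (v : V) (hp : p ∈ U) :
    sumSq e (dirDeriv v F) p = dirDeriv v (sumSq e F) p := by
  have h2 : ∀ i, ContDiffOn ℝ ∞ (dirDeriv (e i) (dirDeriv (e i) F)) U := fun i =>
    contDiffOn_dirDeriv (contDiffOn_dirDeriv hF hU _) hU _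
  have : dirDeriv v (sumSq e F) p
      = ∑ i, dirDeriv v (dirDeriv (e i) (dirDeriv (e i) F)) p :=
    dirDeriv_sum _ (fun i _ => (h2 i).differentiableAt_of_isOpen hU hp) v
  rw [this]
  simp only [sumSq]
  refine Finset.sum_congr rfl fun i _ => ?_
  rw [dirDeriv_congr hU (fun q hq => dirDeriv_comm hF hU (e i) v hq) _ hp,
    dirDeriv_comm (contDiffOn_dirDeriv hF hU _) hU _ _ hp]

end SumSq

/-- Second derivatives in any direction are nonnegative at a local minimum. -/
lemma IsLocalMin.sumSq_nonneg {ι : Type*} [Fintype ι] (e : ι → V)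
    (hF : ContDiffOn ℝ ∞ F U) (hU : IsOpen U) (hp : p ∈ U)
    (hmin : ∀ i, IsLocalMin (fun t : ℝ => F (p + t • e i)) 0) : 0 ≤ sumSq e F p := by
  refine Finset.sum_nonneg fun i _ => ?_
  have hl : ∀ t : ℝ, HasDerivAt (fun t : ℝ => p + t • e i) (e i) t := fun t => by
    simpa using ((hasDerivAt_id t).smul_const (e i)).const_add p
  have hc : Continuous fun t : ℝ => p + t • e i := by fun_prop
  have hnear : ∀ᶠ t : ℝ in nhds 0, p + t • e i ∈ U :=
    hc.continuousAt.eventually_mem (by simpa using hU.mem_nhds hp)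
  have hd : ∀ {H : V → ℝ}, ContDiffOn ℝ ∞ H U → ∀ t : ℝ, p + t • e i ∈ U →
      HasDerivAt (fun t : ℝ => H (p + t • e i)) (dirDeriv (e i) H (p + t • e i)) t :=
    fun hH t ht => (hH.differentiableAt_of_isOpen hU ht).hasFDerivAt.comp_hasDerivAt t (hl t)
  set f : ℝ → ℝ := fun t => F (p + t • e i) with hf
  have h1 : deriv f =ᶠ[nhds 0] fun t => dirDeriv (e i) F (p + t • e i) :=
    hnear.mono fun t ht => (hd hF t ht).deriv
  have h0 : p + (0 : ℝ) • e i = p := by simp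
  have h2 : deriv (deriv f) 0 = dirDeriv (e i) (dirDeriv (e i) F) p := by
    rw [h1.deriv_eq, (hd (contDiffOn_dirDeriv hF hU (e i)) 0 (by rwa [h0])).deriv, h0]
  rw [← h2]
  -- A negative second derivative would make `0` a local maximum as well, so `f` would be locally
  -- constant and its second derivative zero.
  by_contra! hneg
  have hcf : ContinuousAt f 0 := (hd hF 0 (by rwa [h0])).continuousAt
  have hmax := isLocalMax_of_deriv_deriv_neg hneg (hmin i).deriv_eq_zero hcf
  have hconst : f =ᶠ[nhds 0] fun _ => f 0 := by
    filter_upwards [hmax, hmin i] with t ha hb using le_antisymm ha hb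
  have : deriv f =ᶠ[nhds 0] fun _ => 0 := by simpa using hconst.deriv
  rw [this.deriv_eq] at hneg
  simp at hneg

end Calculus

/-! ### The Laplacian in an orthonormal basis and on slices. -/

section Euclidean

variable {E : Type*} [NormedAddCommGroup E] [InnerProductSpace ℝ E]

lemma deriv_slice {F : ℝ × E → ℝ} {u : ℝ} {x : E} (hF : DifferentiableAt ℝ F (u, x)) :
    deriv (fun v => F (v, x)) u = dirDeriv ((1 : ℝ), (0 : E)) F (u, x) := by
  have h1 : HasFDerivAt (fun v : ℝ => (v, x)) (ContinuousLinearMap.inl ℝ ℝ E) u :=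
    hasFDerivAt_prodMk_left u x
  have := (hF.hasFDerivAt.comp u h1).hasDerivAt.deriv
  change deriv (F ∘ fun v => (v, x)) u = _
  rw [this]
  simp [dirDeriv]

variable [FiniteDimensional ℝ E]

lemma laplacian_eq_sumSq {ι : Type*} [Fintype ι] (b : OrthonormalBasis ι ℝ E) {F : E → ℝ} {x : E}
    (hF : ContDiffAt ℝ 2 F x) : Laplacian.laplacian F x = sumSq b F x := by
  rw [InnerProductSpace.laplacian_eq_iteratedFDeriv_orthonormalBasis F b]
  have hd : DifferentiableAt ℝ (fderiv ℝ F) x :=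
    (hF.fderiv_right (m := 1) (by norm_num)).differentiableAt (by simp)
  refine Finset.sum_congr rfl fun i _ => ?_
  rw [iteratedFDeriv_two_apply]
  unfold dirDeriv
  rw [fderiv_clm_apply hd (differentiableAt_const _)]
  simp

/-- `∑ᵢ ∂_{(0, bᵢ)}²` is the Laplacian in the second variable. -/
lemma laplacian_slice {ι : Type*} [Fintype ι] (b : OrthonormalBasis ι ℝ E) {F : ℝ × E → ℝ}
    {U : Set (ℝ × E)} (hU : IsOpen U) (hF : ContDiffOn ℝ ∞ F U) {u : ℝ} {x : E} (hx : (u, x) ∈ U) :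
    Laplacian.laplacian (fun y => F (u, y)) x = sumSq (fun i => ((0 : ℝ), b i)) F (u, x) := by
  have hc : ContDiff ℝ ∞ fun y : E => (u, y) := by fun_prop
  have hat : ContDiffAt ℝ ∞ (fun y => F (u, y)) x :=
    ContDiffAt.comp x (hF.contDiffAt (hU.mem_nhds hx)) hc.contDiffAt
  rw [laplacian_eq_sumSq b (hat.of_le two_le_smooth)]
  have hU' : IsOpen {y : E | (u, y) ∈ U} := hU.preimage hc.continuous
  have key : ∀ {H : ℝ × E → ℝ}, ContDiffOn ℝ ∞ H U → ∀ v : E,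
      Set.EqOn (dirDeriv v fun y => H (u, y)) (fun y => dirDeriv ((0 : ℝ), v) H (u, y))
        {y : E | (u, y) ∈ U} := fun {H} hH v y hy => by
    have h1 : HasFDerivAt (fun y : E => (u, y)) (ContinuousLinearMap.inr ℝ ℝ E) y :=
      hasFDerivAt_prodMk_right u y
    have := (hH.differentiableAt_of_isOpen hU hy).hasFDerivAt.comp y h1
    simp only [dirDeriv]
    change fderiv ℝ (H ∘ fun y => (u, y)) y v = _
    rw [this.fderiv]; simp
  refine Finset.sum_congr rfl fun i _ => ?_
  rw [dirDeriv_congr hU' (key hF (b i)) _ hx, key (contDiffOn_dirDeriv hF hU _) _ hx]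

end Euclidean

/-! ### Powers of shifted squared norms. -/

section Radial

variable {E : Type*} [NormedAddCommGroup E] [InnerProductSpace ℝ E]
  {V : Type*} [NormedAddCommGroup V] [NormedSpace ℝ V]

/-- The shift `c` covers two cases at once: `c = 0` gives pure powers of the norm (hence the
recurring `+ 0`), and `c = ε²` gives the regularised Newtonian kernel. The map `π` lets the same
formulas be used on `E` and on `ℝ × E`. -/
lemma contDiffOn_radial (π : V →L[ℝ] E) (c q : ℝ) :
    ContDiffOn ℝ ∞ (fun p => (‖π p‖ ^ 2 + c) ^ q) {p | 0 < ‖π p‖ ^ 2 + c} := by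
  refine ContDiffOn.rpow_const_of_ne ?_ fun p hp => (ne_of_gt hp)
  exact ((π.contDiff.norm_sq ℝ).add contDiff_const).contDiffOn

lemma dirDeriv_radial (π : V →L[ℝ] E) (c q : ℝ) {p : V} (hp : 0 < ‖π p‖ ^ 2 + c) (v : V) :
    dirDeriv v (fun p => (‖π p‖ ^ 2 + c) ^ q) p
      = 2 * q * (inner ℝ (π p) (π v) * (‖π p‖ ^ 2 + c) ^ (q - 1)) := by
  have h1 : HasFDerivAt (fun p => ‖π p‖ ^ 2 + c) (2 • (innerSL ℝ (π p)).comp π) p :=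
    (π.hasFDerivAt.norm_sq).add_const c
  have h2 := h1.rpow_const (p := q) (Or.inl hp.ne')
  simp only [dirDeriv]
  rw [h2.fderiv]
  simp
  ring

/-- The last factor displays two useful cancellations: for `q = (2 - M) / 2` the `‖π p‖ ^ 2` term
drops out, and for `c = 0` the whole is again a pure power. -/
lemma sumSq_radial {ι : Type*} [Fintype ι] (b : OrthonormalBasis ι ℝ E) (π : V →L[ℝ] E)
    (e : ι → V) (he : ∀ i, π (e i) = b i) (c q : ℝ) {p : V} (hp : 0 < ‖π p‖ ^ 2 + c) :
    sumSq e (fun p => (‖π p‖ ^ 2 + c) ^ q) p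
      = 2 * q * (‖π p‖ ^ 2 + c) ^ (q - 2)
        * ((2 * q - 2 + Module.finrank ℝ E) * ‖π p‖ ^ 2 + Module.finrank ℝ E * c) := by
  have hU : IsOpen {p : V | 0 < ‖π p‖ ^ 2 + c} :=
    isOpen_lt continuous_const (by fun_prop)
  have hterm : ∀ i, dirDeriv (e i) (dirDeriv (e i) fun p => (‖π p‖ ^ 2 + c) ^ q) p
      = 2 * q * (2 * (q - 1) * (‖π p‖ ^ 2 + c) ^ (q - 2) * inner ℝ (π p) (b i) ^ 2
        + (‖π p‖ ^ 2 + c) ^ (q - 1)) := fun i => by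
    rw [dirDeriv_congr hU (fun r hr => dirDeriv_radial π c q hr (e i)) (e i) hp,
      dirDeriv_const_mul, he]
    have hlin : HasFDerivAt (fun r => inner ℝ (π r) (b i)) ((innerSL ℝ (b i)).comp π) p := by
      have := ((innerSL ℝ (b i)).comp π).hasFDerivAt (x := p)
      refine this.congr_of_eventuallyEq (Filter.Eventually.of_forall fun r => ?_)
      simp [real_inner_comm]
    have hd : dirDeriv (e i) (fun r => inner ℝ (π r) (b i)) p = 1 := by
      simp [dirDeriv, hlin.fderiv, he]
    rw [dirDeriv_mul hlin.differentiableAt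
      ((contDiffOn_radial π c (q - 1)).differentiableAt_of_isOpen hU hp),
      dirDeriv_radial π c _ hp, hd, he, show q - 1 - 1 = q - 2 by ring]
    ring
  simp only [sumSq, hterm]
  rw [← Finset.mul_sum, Finset.sum_add_distrib, ← Finset.mul_sum]
  have hsum : ∑ i, inner ℝ (π p) (b i) ^ 2 = ‖π p‖ ^ 2 := by
    have := b.sum_sq_norm_inner_left (π p)
    simpa [real_inner_comm, sq_abs] using this
  have hpow : (‖π p‖ ^ 2 + c) ^ (q - 1) = (‖π p‖ ^ 2 + c) ^ (q - 2) * (‖π p‖ ^ 2 + c) := by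
    rw [← Real.rpow_add_one hp.ne']; congr 1; ring
  rw [hsum, hpow, Finset.sum_const, Finset.card_univ, ← Module.finrank_eq_card_basis b.toBasis,
    nsmul_eq_mul]
  ring

end Radial

/-! ### Homogeneous functions and Poisson's equation on the punctured space. -/

section Homogeneous

/-- The product of a parameter line with the punctured space. -/
def puncturedSpace (E : Type*) [NormedAddCommGroup E] : Set (ℝ × E) := {p | p.2 ≠ 0}

lemma isOpen_puncturedSpace {E : Type*} [NormedAddCommGroup E] : IsOpen (puncturedSpace E) :=
  isOpen_ne.preimage continuous_snd

lemma ne_zero_of_mem_sphere_one {E : Type*} [NormedAddCommGroup E] {y : E} (hy : y ∈ Metric.sphere (0 : E) 1) : y ≠ 0 := by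
  rintro rfl; simp at hy

variable {E : Type*} [NormedAddCommGroup E] [InnerProductSpace ℝ E]

lemma inv_norm_smul_mem_sphere {y : E} (hy : y ≠ 0) : ‖y‖⁻¹ • y ∈ Metric.sphere (0 : E) 1 := by
  simp [norm_smul, inv_mul_cancel₀ (norm_ne_zero_iff.mpr hy)]

/-- Functions of a parameter and a nonzero vector, smooth in both and positively homogeneous of
degree `α` in the vector. -/
structure IsHomog (α : ℝ) (F : ℝ × E → ℝ) : Prop where
  smooth : ContDiffOn ℝ ∞ F (puncturedSpace E)
  homog : ∀ (u : ℝ) (y : E) (t : ℝ), y ≠ 0 → 0 < t → F (u, t • y) = t ^ α * F (u, y)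

namespace IsHomog

variable {α β : ℝ} {F G : ℝ × E → ℝ}

lemma differentiableAt (hF : IsHomog α F) {u : ℝ} {y : E} (hy : y ≠ 0) :
    DifferentiableAt ℝ F (u, y) :=
  hF.smooth.differentiableAt_of_isOpen isOpen_puncturedSpace hy

lemma eq_norm_rpow_mul (hF : IsHomog α F) (u : ℝ) {y : E} (hy : y ≠ 0) :
    F (u, y) = ‖y‖ ^ α * F (u, ‖y‖⁻¹ • y) := by
  have hn : 0 < ‖y‖ := norm_pos_iff.mpr hy
  rw [← hF.homog u _ _ (smul_ne_zero (inv_ne_zero hn.ne') hy) hn, smul_smul,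
    mul_inv_cancel₀ hn.ne', one_smul]

lemma continuousOn_slice (hF : IsHomog α F) (u : ℝ) :
    ContinuousOn (fun y => F (u, y)) {y : E | y ≠ 0} :=
  hF.smooth.continuousOn.comp (by fun_prop) fun _ hy => hy

lemma const_mul (c : ℝ) (hF : IsHomog α F) : IsHomog α fun p => c * F p where
  smooth := contDiffOn_const.mul hF.smooth
  homog u y t hy ht := by rw [hF.homog u y t hy ht]; ring

lemma sub (hF : IsHomog α F) (hG : IsHomog α G) : IsHomog α fun p => F p - G p where
  smooth := hF.smooth.sub hG.smooth
  homog u y t hy ht := by rw [hF.homog u y t hy ht, hG.homog u y t hy ht]; ring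

lemma sum {κ : Type*} (s : Finset κ) {H : κ → ℝ × E → ℝ} (hH : ∀ k ∈ s, IsHomog α (H k)) :
    IsHomog α fun p => ∑ k ∈ s, H k p where
  smooth := ContDiffOn.sum fun k hk => (hH k hk).smooth
  homog u y t hy ht := by
    rw [Finset.mul_sum]
    exact Finset.sum_congr rfl fun k hk => (hH k hk).homog u y t hy ht

lemma mul (hF : IsHomog α F) (hG : IsHomog β G) : IsHomog (α + β) fun p => F p * G p where
  smooth := hF.smooth.mul hG.smooth
  homog u y t hy ht := by
    rw [hF.homog u y t hy ht, hG.homog u y t hy ht, Real.rpow_add ht]; ring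

lemma inner_const (v : E) : IsHomog 1 fun p : ℝ × E => inner ℝ p.2 v where
  smooth := (contDiff_snd.inner ℝ contDiff_const).contDiffOn
  homog u y t _ _ := by simp [inner_smul_left]

lemma norm_rpow (β : ℝ) : IsHomog β fun p : ℝ × E => (‖p.2‖ ^ 2 + 0) ^ (β / 2) where
  smooth := (contDiffOn_radial (ContinuousLinearMap.snd ℝ ℝ E) 0 (β / 2)).mono fun p hp => by
    have := norm_pos_iff.mpr hp
    simp only [ContinuousLinearMap.coe_snd', add_zero, Set.mem_ofPred_eq]; positivity
  homog u y t hy ht := by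
    simp only [add_zero, norm_smul, Real.norm_eq_abs, abs_of_pos ht]
    rw [← Real.rpow_natCast, ← Real.rpow_natCast, ← Real.rpow_mul (by positivity),
      ← Real.rpow_mul (by positivity), Real.mul_rpow ht.le (norm_nonneg _)]
    norm_num
    simp [mul_div_cancel₀]

lemma dirDeriv_snd (hF : IsHomog α F) (v : E) : IsHomog (α - 1) (dirDeriv ((0 : ℝ), v) F) where
  smooth := contDiffOn_dirDeriv hF.smooth isOpen_puncturedSpace _
  homog u y t hy ht := by
    let S : ℝ × E →L[ℝ] ℝ × E :=
      (ContinuousLinearMap.fst ℝ ℝ E).prod (t • ContinuousLinearMap.snd ℝ ℝ E)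
    have h1 : HasFDerivAt (F ∘ S) ((fderiv ℝ F (u, t • y)).comp S) (u, y) :=
      (hF.differentiableAt (smul_ne_zero ht.ne' hy)).hasFDerivAt.comp (u, y) S.hasFDerivAt
    have h2 : Set.EqOn (F ∘ S) (fun p => t ^ α * F p) (puncturedSpace E) := fun p hp =>
      hF.homog p.1 p.2 t hp ht
    have h3 := dirDeriv_congr isOpen_puncturedSpace h2 ((0 : ℝ), v) (x := (u, y)) hy
    rw [dirDeriv_const_mul] at h3
    have h4 : dirDeriv ((0 : ℝ), v) (F ∘ S) (u, y) = t * dirDeriv ((0 : ℝ), v) F (u, t • y) := by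
      simp only [dirDeriv]
      rw [h1.fderiv]
      have : S ((0 : ℝ), v) = t • ((0 : ℝ), v) := by simp [S]
      rw [ContinuousLinearMap.comp_apply, this, map_smul, smul_eq_mul]
    rw [h4] at h3
    rw [Real.rpow_sub_one ht.ne']
    field_simp
    linarith

lemma dirDeriv_fst (hF : IsHomog α F) : IsHomog α (dirDeriv ((1 : ℝ), (0 : E)) F) where
  smooth := contDiffOn_dirDeriv hF.smooth isOpen_puncturedSpace _
  homog u y t hy ht := by
    rw [← deriv_slice (hF.differentiableAt (smul_ne_zero ht.ne' hy)),
      ← deriv_slice (hF.differentiableAt hy)]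
    have : (fun v => F (v, t • y)) = fun v => t ^ α * F (v, y) :=
      funext fun v => hF.homog v y t hy ht
    rw [this, deriv_const_mul_field]

lemma dirDeriv_radial (hF : IsHomog α F) (u : ℝ) {y : E} (hy : y ≠ 0) :
    dirDeriv ((0 : ℝ), y) F (u, y) = α * F (u, y) := by
  have h1 : HasDerivAt (fun t : ℝ => (u, t • y)) ((0 : ℝ), y) 1 := by
    have := (hasDerivAt_const (1 : ℝ) u).prodMk ((hasDerivAt_id (1 : ℝ)).smul_const y)
    simpa using this
  have hd : DifferentiableAt ℝ F (u, (1 : ℝ) • y) := hF.differentiableAt (by simpa)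
  have h2 := hd.hasFDerivAt.comp_hasDerivAt (1 : ℝ) h1
  have h3 : HasDerivAt (fun t : ℝ => t ^ α * F (u, y)) (α * F (u, y)) 1 := by
    simpa using (Real.hasDerivAt_rpow_const (x := 1) (p := α) (by simp)).mul_const (F (u, y))
  have h4 : (F ∘ fun t : ℝ => (u, t • y)) =ᶠ[nhds 1] fun t => t ^ α * F (u, y) := by
    filter_upwards [lt_mem_nhds (zero_lt_one' ℝ)] with t ht using hF.homog u y t hy ht
  have := h2.unique (h3.congr_of_eventuallyEq h4)
  rw [one_smul] at this
  exact this

lemma euler {ι : Type*} [Fintype ι] (b : OrthonormalBasis ι ℝ E) (hF : IsHomog α F) (u : ℝ) {y : E}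
    (hy : y ≠ 0) :
    ∑ i, inner ℝ y (b i) * dirDeriv ((0 : ℝ), b i) F (u, y) = α * F (u, y) := by
  rw [← hF.dirDeriv_radial u hy]
  simp only [dirDeriv]
  have : ((0 : ℝ), y) = ∑ i, inner ℝ y (b i) • ((0 : ℝ), b i) := by
    refine Prod.ext (by simp [Prod.fst_sum]) ?_
    conv_lhs => rw [← b.sum_repr' y]
    simp [Prod.snd_sum, real_inner_comm]
  conv_rhs => rw [this]
  rw [map_sum]
  exact Finset.sum_congr rfl fun i _ => by rw [map_smul, smul_eq_mul]

end IsHomog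

variable [FiniteDimensional ℝ E]

/-- The Laplacian in the second variable. -/
noncomputable def fiberLaplacian (F : ℝ × E → ℝ) : ℝ × E → ℝ :=
  sumSq (fun i => ((0 : ℝ), stdOrthonormalBasis ℝ E i)) F

variable {α β : ℝ} {F G : ℝ × E → ℝ}

lemma IsHomog.isHomog_fiberLaplacian (hF : IsHomog α F) :
    IsHomog (α - 2) (fiberLaplacian F) :=
  IsHomog.sum Finset.univ fun i _ => by
    have := (hF.dirDeriv_snd (stdOrthonormalBasis ℝ E i)).dirDeriv_snd (stdOrthonormalBasis ℝ E i)
    rwa [show α - 1 - 1 = α - 2 by ring] at this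

lemma fiberLaplacian_norm_rpow (β : ℝ) {p : ℝ × E} (hp : p ∈ puncturedSpace E) :
    fiberLaplacian (fun p : ℝ × E => (‖p.2‖ ^ 2 + 0) ^ (β / 2)) p
      = β * (β + Module.finrank ℝ E - 2) * (‖p.2‖ ^ 2 + 0) ^ (β / 2 - 1) := by
  have hn : 0 < ‖p.2‖ := norm_pos_iff.mpr hp
  have h0 : 0 < ‖p.2‖ ^ 2 + 0 := by positivity
  have := sumSq_radial (stdOrthonormalBasis ℝ E) (ContinuousLinearMap.snd ℝ ℝ E)
    (fun i => ((0 : ℝ), stdOrthonormalBasis ℝ E i)) (fun i => rfl) 0 (β / 2) (p := p) h0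
  simp only [ContinuousLinearMap.coe_snd'] at this
  rw [fiberLaplacian, this, show β / 2 - 1 = β / 2 - 2 + 1 by ring, Real.rpow_add_one h0.ne']
  ring

variable (E) in
/-- The only homogeneous harmonic function of degree `α` on the punctured space is `0`. -/
def HarmonicUnique (α : ℝ) : Prop :=
  ∀ F : ℝ × E → ℝ, IsHomog α F → (∀ p ∈ puncturedSpace E, fiberLaplacian F p = 0) →
    ∀ p ∈ puncturedSpace E, F p = 0

variable (E) in
/-- Poisson's equation with a homogeneous right-hand side has a solution homogeneous of
degree `α`. -/
def PoissonSolvable (α : ℝ) : Prop :=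
  ∀ G : ℝ × E → ℝ, IsHomog (α - 2) G →
    ∃ F, IsHomog α F ∧ ∀ p ∈ puncturedSpace E, fiberLaplacian F p = G p

/-- Maximum principle on the sphere. -/
lemma IsHomog.nonpos_of_harmonic (hα : α < 0) (hα' : 2 - (Module.finrank ℝ E : ℝ) < α)
    (hF : IsHomog α F) (h0 : ∀ p ∈ puncturedSpace E, fiberLaplacian F p = 0)
    {p : ℝ × E} (hp : p ∈ puncturedSpace E) : F p ≤ 0 := by
  obtain ⟨u, y⟩ := p
  have hn : 0 < ‖y‖ := norm_pos_iff.mpr hp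
  have hcont : ContinuousOn (fun z => F (u, z)) (Metric.sphere (0 : E) 1) :=
    (hF.continuousOn_slice u).mono fun z hz => ne_zero_of_mem_sphere_one hz
  obtain ⟨x, hx, hmax⟩ := (isCompact_sphere (0 : E) 1).exists_isMaxOn ⟨_, inv_norm_smul_mem_sphere (y := y) hp⟩ hcont
  have hx0 := ne_zero_of_mem_sphere_one hx
  have hx1 : ‖x‖ = 1 := by simpa using hx
  -- The barrier is the pure power of degree `α` touching `F` from above at the maximum point `x` of
  -- the sphere. Homogeneity extends the comparison from the sphere to all `z ≠ 0`.
  have hle : ∀ z : E, z ≠ 0 → F (u, z) ≤ F (u, x) * (‖z‖ ^ 2 + 0) ^ (α / 2) := fun z hz => by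
    have hz' : 0 < ‖z‖ := norm_pos_iff.mpr hz
    have : (‖z‖ ^ 2 + 0) ^ (α / 2) = ‖z‖ ^ α := by
      rw [add_zero, ← Real.rpow_natCast, ← Real.rpow_mul hz'.le]; norm_num
      simp [mul_div_cancel₀]
    rw [this, hF.eq_norm_rpow_mul u hz, mul_comm (F _)]
    exact mul_le_mul_of_nonneg_left (hmax (inv_norm_smul_mem_sphere hz)) (by positivity)
  rcases le_or_gt (F (u, x)) 0 with hneg | hpos
  · exact (hle y hp).trans (mul_nonpos_of_nonpos_of_nonneg hneg (by positivity))
  exfalso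
  have hN := (IsHomog.norm_rpow (E := E) α).const_mul (F (u, x))
  have hmin := IsLocalMin.sumSq_nonneg (fun i => ((0 : ℝ), stdOrthonormalBasis ℝ E i))
    (hN.sub hF).smooth isOpen_puncturedSpace (p := (u, x)) hx0 fun i => by
      have hc : Continuous fun t : ℝ => x + t • stdOrthonormalBasis ℝ E i := by fun_prop
      have hev : ∀ᶠ t : ℝ in nhds 0, x + t • stdOrthonormalBasis ℝ E i ≠ 0 :=
        hc.continuousAt.eventually_ne (by simpa)
      filter_upwards [hev] with t ht
      have := hle _ ht
      simp only [Prod.smul_mk, smul_zero, Prod.mk_add_mk, add_zero, zero_smul, hx1] at this ⊢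
      simp only [one_pow, Real.one_rpow, mul_one, sub_self]
      linarith
  have heq := sumSq_sub (fun i => ((0 : ℝ), stdOrthonormalBasis ℝ E i)) hN.smooth hF.smooth
    isOpen_puncturedSpace (p := (u, x)) hx0
  have h0' : sumSq (fun i => ((0 : ℝ), stdOrthonormalBasis ℝ E i)) F (u, x) = 0 := h0 _ hx0
  have h1 := fiberLaplacian_norm_rpow α (p := (u, x)) hx0
  rw [fiberLaplacian] at h1
  rw [heq, sumSq_const_mul, h1, h0'] at hmin
  simp only [hx1, one_pow, add_zero, Real.one_rpow, mul_one, sub_zero] at hmin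
  -- Barrier minus `F` has a minimum at `x`, so its Laplacian there is nonnegative. That Laplacian
  -- is `F (u, x)` times this negative number.
  have : α * (α + Module.finrank ℝ E - 2) < 0 := mul_neg_of_neg_of_pos hα (by linarith)
  nlinarith

lemma harmonicUnique_of_neg (hα : α < 0) (hα' : 2 - (Module.finrank ℝ E : ℝ) < α) :
    HarmonicUnique E α := fun F hF h0 p hp => by
  refine le_antisymm (hF.nonpos_of_harmonic hα hα' h0 hp) ?_
  have := (hF.const_mul (-1)).nonpos_of_harmonic hα hα' (fun q hq => by
    rw [fiberLaplacian, sumSq_const_mul]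
    have := h0 q hq
    rw [fiberLaplacian] at this
    simp [this]) hp
  linarith

/-- The spatial derivatives of `F` are harmonic of degree `α - 1`, hence zero, and Euler's relation
recovers `α F` from them. -/
lemma HarmonicUnique.succ (h : HarmonicUnique E (α - 1)) (hα : α ≠ 0) : HarmonicUnique E α :=
  fun F hF h0 p hp => by
    have hd : ∀ v : E, dirDeriv ((0 : ℝ), v) F p = 0 := fun v =>
      h _ (hF.dirDeriv_snd v) (fun q hq => by
        rw [fiberLaplacian, sumSq_dirDeriv _ hF.smooth isOpen_puncturedSpace _ hq]
        have := dirDeriv_congr (G := fun _ => 0) isOpen_puncturedSpace h0 ((0 : ℝ), v) hq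
        exact this.trans (by simp [dirDeriv])) p hp
    have := hF.dirDeriv_radial p.1 (y := p.2) hp
    rw [hd] at this
    exact (mul_eq_zero.mp this.symm).resolve_left hα

/-- Solve `Δ Hᵢ = ∂ᵢ G` in degree `α - 1`. The function `∑ ∂ᵢ Hᵢ - G` is harmonic of degree `α - 2`,
hence zero. With `F = α⁻¹ ∑ xᵢ Hᵢ` the product rule gives `α Δ F = ∑ xᵢ ∂ᵢ G + 2 ∑ ∂ᵢ Hᵢ`, which is
`(α - 2) G + 2 G = α G` by Euler's relation. -/
lemma PoissonSolvable.succ (h : PoissonSolvable E (α - 1)) (h' : HarmonicUnique E (α - 2))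
    (hα : α ≠ 0) : PoissonSolvable E α := fun G hG => by
  set b := stdOrthonormalBasis ℝ E with hb
  have hU := isOpen_puncturedSpace (E := E)
  have hG' : ∀ i, IsHomog (α - 1 - 2) (dirDeriv ((0 : ℝ), b i) G) := fun i => by
    have := hG.dirDeriv_snd (b i)
    rwa [show α - 2 - 1 = α - 1 - 2 by ring] at this
  choose H hH hHG using fun i => h _ (hG' i)
  have hdiv : IsHomog (α - 2) fun p => ∑ i, dirDeriv ((0 : ℝ), b i) (H i) p :=
    IsHomog.sum _ fun i _ => by
      have := (hH i).dirDeriv_snd (b i)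
      rwa [show α - 1 - 1 = α - 2 by ring] at this
  have hdivG : ∀ p ∈ puncturedSpace E, ∑ i, dirDeriv ((0 : ℝ), b i) (H i) p = G p := by
    intro p hp
    refine sub_eq_zero.mp (h' _ (hdiv.sub hG) (fun q hq => ?_) p hp)
    rw [fiberLaplacian, sumSq_sub _ hdiv.smooth hG.smooth hU hq,
      sumSq_sum _ _ (fun i _ => contDiffOn_dirDeriv (hH i).smooth hU _) hU hq]
    simp only [sumSq_dirDeriv _ (hH _).smooth hU _ hq]
    have := Finset.sum_congr rfl fun i (_ : i ∈ Finset.univ) =>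
      dirDeriv_congr hU (hHG i) ((0 : ℝ), b i) hq
    exact sub_eq_zero.mpr this
  have hprod : ∀ i, IsHomog α fun p => inner ℝ p.2 (b i) * H i p := fun i => by
    have := (IsHomog.inner_const (b i)).mul (hH i)
    rwa [show 1 + (α - 1) = α by ring] at this
  refine ⟨fun p => α⁻¹ * ∑ i, inner ℝ p.2 (b i) * H i p,
    (IsHomog.sum _ fun i _ => hprod i).const_mul _, fun p hp => ?_⟩
  have hx : ∀ (i : Fin (Module.finrank ℝ E)) (v : E),
      dirDeriv ((0 : ℝ), v) (fun p : ℝ × E => inner ℝ p.2 (b i)) = fun _ => inner ℝ v (b i) := by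
    intro i v; ext q
    have : HasFDerivAt (fun p : ℝ × E => inner ℝ p.2 (b i))
        ((innerSL ℝ (b i)).comp (ContinuousLinearMap.snd ℝ ℝ E)) q := by
      refine ((innerSL ℝ (b i)).comp (ContinuousLinearMap.snd ℝ ℝ E)).hasFDerivAt
        |>.congr_of_eventuallyEq (Filter.Eventually.of_forall fun r => ?_)
      simp [real_inner_comm]
    simp [dirDeriv, this.fderiv, real_inner_comm]
  have hterm : ∀ i, fiberLaplacian (fun p => inner ℝ p.2 (b i) * H i p) p
      = inner ℝ p.2 (b i) * dirDeriv ((0 : ℝ), b i) G p + 2 * dirDeriv ((0 : ℝ), b i) (H i) p := by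
    intro i
    rw [fiberLaplacian, sumSq_mul _ (IsHomog.inner_const (b i)).smooth (hH i).smooth hU hp]
    have h1 : sumSq (fun i => ((0 : ℝ), b i)) (H i) p = dirDeriv ((0 : ℝ), b i) G p := hHG i p hp
    have h2 : sumSq (fun i => ((0 : ℝ), b i)) (fun p => inner ℝ p.2 (b i)) p = 0 := by
      simp only [sumSq, hx]; simp [dirDeriv]
    rw [h1, h2]
    have h3 : ∀ x, inner ℝ (stdOrthonormalBasis ℝ E x) (b i) = if x = i then (1 : ℝ) else 0 :=
      fun x => orthonormal_iff_ite.mp b.orthonormal x i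
    simp only [hx, h3]
    simp [hb]
  rw [fiberLaplacian, sumSq_const_mul, sumSq_sum _ _ (fun i _ => (hprod i).smooth) hU hp]
  have : ∑ i, sumSq (fun i => ((0 : ℝ), b i)) (fun p => inner ℝ p.2 (b i) * H i p) p
      = α * G p := by
    refine (Finset.sum_congr rfl fun i _ => hterm i).trans ?_
    rw [Finset.sum_add_distrib, ← Finset.mul_sum, hdivG p hp]
    have := hG.euler b p.1 (y := p.2) hp
    rw [this]; ring
  rw [this, inv_mul_cancel_left₀ hα]

end Homogeneous

/-! ### Smooth dependence of integrals over compact sets on parameters. -/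

section ParametricIntegral

universe u

variable {P F : Type u} [NormedAddCommGroup P] [NormedSpace ℝ P] [NormedAddCommGroup F]
  [NormedSpace ℝ F] {Q : Type*} [NormedAddCommGroup Q] [NormedSpace ℝ Q] [MeasurableSpace Q]
  [BorelSpace Q] {μ : Measure Q} {K : Set Q} {W : Set (P × Q)}

lemma isOpen_forall_mem_of_isCompact {X Y : Type*} [TopologicalSpace X] [TopologicalSpace Y]
    {K : Set Y} {W : Set (X × Y)} (hK : IsCompact K) (hW : IsOpen W) :
    IsOpen {p | ∀ q ∈ K, (p, q) ∈ W} := by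
  rw [isOpen_iff_forall_mem_open]
  intro p hp
  obtain ⟨u, v, hu, -, hpu, hKv, huv⟩ := generalized_tube_lemma (isCompact_singleton (x := p)) hK hW
    (by rintro ⟨a, q⟩ ⟨rfl, hq⟩; exact hp q hq)
  exact ⟨u, fun a ha q hq => huv ⟨ha, hKv hq⟩, hu, hpu rfl⟩

lemma hasFDerivAt_setIntegral_of_isCompact (hK : IsCompact K) (hW : IsOpen W) (hμ : μ K ≠ ⊤)
    {Ψ : P × Q → F} (hΨ : ContDiffOn ℝ ∞ Ψ W) {p : P} (hp : ∀ q ∈ K, (p, q) ∈ W) :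
    HasFDerivAt (fun p => ∫ q in K, Ψ (p, q) ∂μ)
      (∫ q in K, (fderiv ℝ Ψ (p, q)).comp (ContinuousLinearMap.inl ℝ P Q) ∂μ) p := by
  have hKm : MeasurableSet K := hK.isClosed.measurableSet
  set D : P × Q → P →L[ℝ] F := fun z => (fderiv ℝ Ψ z).comp (ContinuousLinearMap.inl ℝ P Q)
    with hD
  have hDc : ContinuousOn D W :=
    (hΨ.continuousOn_fderiv_of_isOpen hW (by simp)).clm_comp continuousOn_const
  have hslice : ∀ {H : Type u} [NormedAddCommGroup H] {f : P × Q → H}, ContinuousOn f W →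
      ∀ p', (∀ q ∈ K, (p', q) ∈ W) → ContinuousOn (fun q => f (p', q)) K :=
    fun hf p' hp' => hf.comp (by fun_prop) hp'
  have hopen := isOpen_forall_mem_of_isCompact hK hW
  obtain ⟨C, hC⟩ := hK.exists_bound_of_continuousOn (hslice hDc p hp)
  -- The bound `C` on `D` holds over `K` at the single parameter `p`. Relaxing it to the open
  -- condition `< C + 1` makes it persist for all nearby parameters, by compactness of `K`.
  have hN : IsOpen (W ∩ D ⁻¹' {A | ‖A‖ < C + 1}) :=
    hDc.isOpen_inter_preimage hW (isOpen_lt continuous_norm continuous_const)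
  have hs : {p' | ∀ q ∈ K, (p', q) ∈ W ∩ D ⁻¹' {A | ‖A‖ < C + 1}} ∈ nhds p :=
    (isOpen_forall_mem_of_isCompact hK hN).mem_nhds fun q hq =>
      ⟨hp q hq, (hC q hq).trans_lt (by linarith)⟩
  have hfin : IsFiniteMeasure (μ.restrict K) := ⟨by simpa using hμ.lt_top⟩
  refine hasFDerivAt_integral_of_dominated_of_fderiv_le (bound := fun _ => C + 1)
    (F' := fun p' q => D (p', q)) hs ?_ ?_ ?_ ?_ (integrable_const _) ?_
  · filter_upwards [hopen.mem_nhds hp] with p' hp'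
    exact (hslice hΨ.continuousOn p' hp').aestronglyMeasurable_of_isCompact hK hKm
  · obtain ⟨B, hB⟩ := hK.exists_bound_of_continuousOn (hslice hΨ.continuousOn p hp)
    exact Integrable.mono' (integrable_const B)
      ((hslice hΨ.continuousOn p hp).aestronglyMeasurable_of_isCompact hK hKm)
      (ae_restrict_of_forall_mem hKm hB)
  · exact (hslice hDc p hp).aestronglyMeasurable_of_isCompact hK hKm
  · exact ae_restrict_of_forall_mem hKm fun q hq p' hp' => (hp' q hq).2.le
  · refine ae_restrict_of_forall_mem hKm fun q hq p' hp' => ?_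
    have h1 : HasFDerivAt (fun a : P => (a, q)) (ContinuousLinearMap.inl ℝ P Q) p' :=
      hasFDerivAt_prodMk_left p' q
    exact ((hΨ.contDiffAt (hW.mem_nhds (hp' q hq).1)).differentiableAt
      (by simp)).hasFDerivAt.comp p' h1

/-- Integrals over a compact set of a smooth function depend smoothly on parameters. -/
theorem contDiffOn_setIntegral_of_isCompact (hK : IsCompact K) (hW : IsOpen W) (hμ : μ K ≠ ⊤)
    {Ψ : P × Q → F} (hΨ : ContDiffOn ℝ ∞ Ψ W) :
    ContDiffOn ℝ ∞ (fun p => ∫ q in K, Ψ (p, q) ∂μ) {p | ∀ q ∈ K, (p, q) ∈ W} := by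
  have hopen := isOpen_forall_mem_of_isCompact hK hW
  rw [contDiffOn_infty]
  intro n
  -- The derivative is an integral of the same kind with values in `P →L[ℝ] F`. The induction must
  -- therefore vary `F`, which is why `P` and `F` share a universe.
  induction n generalizing F with
  | zero =>
    rw [Nat.cast_zero, contDiffOn_zero]
    exact fun p hp =>
      (hasFDerivAt_setIntegral_of_isCompact hK hW hμ hΨ hp).continuousAt.continuousWithinAt
  | succ n ih =>
    rw [Nat.cast_succ, contDiffOn_succ_iff_fderiv_of_isOpen hopen]
    refine ⟨fun p hp => (hasFDerivAt_setIntegral_of_isCompact hK hW hμ hΨ hp).differentiableAt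
      |>.differentiableWithinAt, by simp, ?_⟩
    have hD : ContDiffOn ℝ ∞
        (fun z => (fderiv ℝ Ψ z).comp (ContinuousLinearMap.inl ℝ P Q)) W :=
      (hΨ.fderiv_of_isOpen hW (by simp)).clm_comp contDiffOn_const
    exact (ih hD).congr fun p hp =>
      (hasFDerivAt_setIntegral_of_isCompact hK hW hμ hΨ hp).fderiv

end ParametricIntegral

/-! ### Supports and smoothness of derivatives of test functions. -/

section SupportOfDerivatives

variable {E : Type*} [NormedAddCommGroup E] [NormedSpace ℝ E] {h : E → ℝ}

lemma tsupport_dirDeriv_subset (h : E → ℝ) (v : E) : tsupport (dirDeriv v h) ⊆ tsupport h :=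
  tsupport_fderiv_apply_subset ℝ v

lemma contDiff_dirDeriv (hh : ContDiff ℝ ∞ h) (v : E) : ContDiff ℝ ∞ (dirDeriv v h) :=
  contDiffOn_univ.mp (contDiffOn_dirDeriv hh.contDiffOn isOpen_univ v)

lemma hasCompactSupport_dirDeriv (hc : HasCompactSupport h) (v : E) :
    HasCompactSupport (dirDeriv v h) := hc.fderiv_apply ℝ v

lemma hasCompactSupport_sumSq {ι : Type*} [Fintype ι] (e : ι → E) (hc : HasCompactSupport h) :
    HasCompactSupport (sumSq e h) :=
  hc.mono' fun x hx => by
    by_contra hn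
    refine hx (Finset.sum_eq_zero fun i _ => ?_)
    exact image_eq_zero_of_notMem_tsupport fun hm =>
      hn (tsupport_dirDeriv_subset _ _ (tsupport_dirDeriv_subset _ _ hm))

lemma tsupport_sumSq_subset {ι : Type*} [Fintype ι] (e : ι → E) (h : E → ℝ) :
    tsupport (sumSq e h) ⊆ tsupport h :=
  closure_minimal (fun x hx => by
    by_contra hn
    refine hx (Finset.sum_eq_zero fun i _ => ?_)
    exact image_eq_zero_of_notMem_tsupport fun hm =>
      hn (tsupport_dirDeriv_subset _ _ (tsupport_dirDeriv_subset _ _ hm))) (isClosed_tsupport h)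

lemma contDiff_sumSq {ι : Type*} [Fintype ι] (e : ι → E) (hh : ContDiff ℝ ∞ h) :
    ContDiff ℝ ∞ (sumSq e h) :=
  contDiffOn_univ.mp (contDiffOn_sumSq e hh.contDiffOn isOpen_univ)

lemma sumSq_comp_add_right {ι : Type*} [Fintype ι] (e : ι → E) (h : E → ℝ) (y x : E) :
    sumSq e (fun z => h (z + y)) x = sumSq e h (x + y) := by
  have : ∀ (g : E → ℝ) (v : E), dirDeriv v (fun z => g (z + y)) = fun z => dirDeriv v g (z + y) :=
    fun g v => funext fun z => by simp [dirDeriv, fderiv_comp_add_right]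
  simp [sumSq, this]

end SupportOfDerivatives

/-! ### Integration by parts against test functions. -/

section TestFunctions

variable {E : Type*} [NormedAddCommGroup E] [InnerProductSpace ℝ E] [FiniteDimensional ℝ E]
  [MeasurableSpace E] [BorelSpace E] {U : Set E} {f h : E → ℝ}

lemma integrable_mul_of_tsupport_subset (hf : ContinuousOn f U) (hh : Continuous h)
    (hc : HasCompactSupport h) (hs : tsupport h ⊆ U) : Integrable fun x => f x * h x := by
  have hK : IsCompact (tsupport h) := hc
  have : IntegrableOn (fun x => f x * h x) (tsupport h) :=
    ((hf.mono hs).mul hh.continuousOn).integrableOn_compact hK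
  refine (integrableOn_iff_integrable_of_support_subset fun x hx => subset_tsupport h ?_).mp this
  exact right_ne_zero_of_mul hx

lemma integral_mul_dirDeriv (hU : IsOpen U) (hf : ContDiffOn ℝ ∞ f U) (hh : ContDiff ℝ ∞ h)
    (hc : HasCompactSupport h) (hs : tsupport h ⊆ U) (v : E) :
    ∫ x, f x * dirDeriv v h x = - ∫ x, dirDeriv v f x * h x := by
  refine integral_mul_fderiv_eq_neg_fderiv_mul_of_integrable (μ := volume) ?_ ?_ ?_
    (fun x hx => hf.differentiableAt_of_isOpen hU (hs hx))
    (fun x _ => (hh.differentiable (by simp)) x)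
  · exact integrable_mul_of_tsupport_subset (contDiffOn_dirDeriv hf hU v).continuousOn
      hh.continuous hc hs
  · exact integrable_mul_of_tsupport_subset hf.continuousOn (contDiff_dirDeriv hh v).continuous
      (hasCompactSupport_dirDeriv hc v) ((tsupport_dirDeriv_subset h v).trans hs)
  · exact integrable_mul_of_tsupport_subset hf.continuousOn hh.continuous hc hs

/-- Two integrations by parts. Smoothness of `f` is required only on a neighbourhood `U` of the
support of `h`, so `f` may be singular at the origin. -/
lemma integral_mul_sumSq {ι : Type*} [Fintype ι] (e : ι → E) (hU : IsOpen U)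
    (hf : ContDiffOn ℝ ∞ f U) (hh : ContDiff ℝ ∞ h) (hc : HasCompactSupport h)
    (hs : tsupport h ⊆ U) :
    ∫ x, f x * sumSq e h x = ∫ x, sumSq e f x * h x := by
  have hs1 : ∀ v, tsupport (dirDeriv v h) ⊆ U := fun v =>
    (tsupport_dirDeriv_subset h v).trans hs
  have hd := fun v => contDiff_dirDeriv hh v
  have hcd := fun v => hasCompactSupport_dirDeriv hc v
  have hfd := fun v => contDiffOn_dirDeriv hf hU v
  simp only [sumSq, Finset.mul_sum, Finset.sum_mul]
  rw [integral_finsetSum _ fun i _ => integrable_mul_of_tsupport_subset hf.continuousOn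
      (contDiff_dirDeriv (hd (e i)) (e i)).continuous (hasCompactSupport_dirDeriv (hcd _) _)
      ((tsupport_dirDeriv_subset _ _).trans (hs1 _)),
    integral_finsetSum _ fun i _ => integrable_mul_of_tsupport_subset
      (contDiffOn_dirDeriv (hfd (e i)) hU (e i)).continuousOn hh.continuous hc hs]
  refine Finset.sum_congr rfl fun i _ => ?_
  rw [integral_mul_dirDeriv hU hf (hd _) (hcd _) (hs1 _),
    integral_mul_dirDeriv hU (hfd _) hh hc hs, neg_neg]

end TestFunctions

/-! ### The fundamental solution of the Laplacian. -/

section FundamentalSolution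

variable {E : Type*} [NormedAddCommGroup E] [InnerProductSpace ℝ E] [FiniteDimensional ℝ E]
  [MeasurableSpace E] [BorelSpace E]

variable (E) in
/-- The normalising constant of the Newtonian kernel `‖x‖ ^ (2 - M)`, `M = dim E`. -/
noncomputable def newtonConst : ℝ :=
  ((Module.finrank ℝ E : ℝ) - 2) * Module.finrank ℝ E
    * ∫ z : E, (1 + ‖z‖ ^ 2) ^ (-((Module.finrank ℝ E : ℝ) + 2) / 2)

lemma newtonConst_pos (hM : 3 ≤ Module.finrank ℝ E) : 0 < newtonConst E := by
  have hM' : (3 : ℝ) ≤ Module.finrank ℝ E := by exact_mod_cast hM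
  refine mul_pos (mul_pos (by linarith) (by linarith)) ?_
  have hint : Integrable fun z : E => (1 + ‖z‖ ^ 2) ^ (-((Module.finrank ℝ E : ℝ) + 2) / 2) :=
    integrable_rpow_neg_one_add_norm_sq (by linarith)
  rw [integral_pos_iff_support_of_nonneg (fun z => by positivity) hint]
  have : (Function.support fun z : E => (1 + ‖z‖ ^ 2) ^ (-((Module.finrank ℝ E : ℝ) + 2) / 2))
      = Set.univ := Set.eq_univ_of_forall fun z => by
    have : (0 : ℝ) < (1 + ‖z‖ ^ 2) ^ (-((Module.finrank ℝ E : ℝ) + 2) / 2) := by positivity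
    exact this.ne'
  rw [this]
  exact Measure.measure_univ_pos.mpr (NeZero.ne _)

/-- Moving the Laplacian onto the regularised kernel produces `-(M - 2) M ε² (‖x‖² + ε²) ^ (-(M + 2)
/ 2)`. Substituting `x = ε z` cancels every power of `ε` except the one inside `h`. -/
lemma integral_regularized_mul_sumSq (b : OrthonormalBasis (Fin (Module.finrank ℝ E)) ℝ E)
    {h : E → ℝ} (hh : ContDiff ℝ ∞ h) (hc : HasCompactSupport h) {ε : ℝ} (hε : 0 < ε) :
    ∫ x : E, (‖x‖ ^ 2 + ε ^ 2) ^ ((2 - (Module.finrank ℝ E : ℝ)) / 2) * sumSq b h x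
      = ∫ z : E, -(((Module.finrank ℝ E : ℝ) - 2) * Module.finrank ℝ E)
        * ((1 + ‖z‖ ^ 2) ^ (-((Module.finrank ℝ E : ℝ) + 2) / 2) * h (ε • z)) := by
  obtain ⟨M, hM⟩ : ∃ M : ℝ, M = Module.finrank ℝ E := ⟨_, rfl⟩
  rw [← hM]
  have hpos : ∀ x : E, 0 < ‖x‖ ^ 2 + ε ^ 2 := fun x => by positivity
  have hsm : ContDiffOn ℝ ∞ (fun p : E => (‖p‖ ^ 2 + ε ^ 2) ^ ((2 - M) / 2)) Set.univ :=
    (contDiffOn_radial (ContinuousLinearMap.id ℝ E) (ε ^ 2) ((2 - M) / 2)).mono fun x _ => hpos x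
  have hlap := fun x : E => sumSq_radial b (ContinuousLinearMap.id ℝ E) b (fun i => rfl) (ε ^ 2)
    ((2 - M) / 2) (p := x) (hpos x)
  simp only [ContinuousLinearMap.coe_id', id_eq] at hlap
  rw [integral_mul_sumSq b isOpen_univ hsm hh hc (Set.subset_univ _)]
  have key := Measure.integral_comp_smul (volume : Measure E)
    (fun x => sumSq b (fun p => (‖p‖ ^ 2 + ε ^ 2) ^ ((2 - M) / 2)) x * h x) ε
  have hεM : 0 < ε ^ Module.finrank ℝ E := by positivity
  rw [abs_of_pos (by positivity), smul_eq_mul, eq_inv_mul_iff_mul_eq₀ hεM.ne',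
    ← MeasureTheory.integral_const_mul] at key
  rw [← key]
  refine integral_congr_ae (Filter.Eventually.of_forall fun z => ?_)
  have h1 : ‖ε • z‖ ^ 2 + ε ^ 2 = ε ^ 2 * (1 + ‖z‖ ^ 2) := by
    rw [norm_smul, Real.norm_eq_abs, mul_pow, sq_abs]; ring
  have h2 : (ε ^ 2 * (1 + ‖z‖ ^ 2)) ^ ((2 - M) / 2 - 2)
      = (ε ^ Module.finrank ℝ E)⁻¹ * (ε ^ 2)⁻¹ * (1 + ‖z‖ ^ 2) ^ (-(M + 2) / 2) := by
    rw [Real.mul_rpow (by positivity) (by positivity), show (2 - M) / 2 - 2 = -(M + 2) / 2 by ring,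
      ← Real.rpow_natCast ε 2, ← Real.rpow_mul hε.le, ← Real.rpow_natCast ε, ← hM,
      ← Real.rpow_neg hε.le, ← Real.rpow_neg hε.le, ← Real.rpow_add hε]
    congr 2
    push_cast; ring
  simp only []
  rw [hlap, h1, h2, ← hM]
  field_simp
  ring

lemma locallyIntegrable_norm_rpow {s : ℝ} (hE : 1 ≤ Module.finrank ℝ E)
    (hs : -(Module.finrank ℝ E : ℝ) < s) : LocallyIntegrable fun x : E => ‖x‖ ^ s :=
  locallyIntegrable_of_norm_le_rpow (C := 1) (α := -s) hE (by linarith)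
    (Filter.Eventually.of_forall fun x => by
      rw [neg_neg, one_mul, Real.norm_of_nonneg (by positivity)])
    (Measurable.aestronglyMeasurable (by fun_prop))

/-- Let `ε → 0` in the regularised identity, by dominated convergence on both sides. The kernels on
the left lie below `‖x‖ ^ (2 - M)`, which is locally integrable; on the right the profile is
integrable and `h` is bounded. -/
lemma integral_norm_rpow_mul_sumSq (hM : 3 ≤ Module.finrank ℝ E)
    (b : OrthonormalBasis (Fin (Module.finrank ℝ E)) ℝ E)
    {h : E → ℝ} (hh : ContDiff ℝ ∞ h) (hc : HasCompactSupport h) :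
    ∫ x : E, ‖x‖ ^ (2 - (Module.finrank ℝ E : ℝ)) * sumSq b h x = -(newtonConst E * h 0) := by
  have hM' : (3 : ℝ) ≤ Module.finrank ℝ E := by exact_mod_cast hM
  set ε : ℕ → ℝ := fun n => 1 / ((n : ℝ) + 1) with hε
  have hεpos : ∀ n, 0 < ε n := fun n => by positivity
  have hε0 : Filter.Tendsto ε Filter.atTop (nhds 0) := tendsto_one_div_add_atTop_nhds_zero_nat
  have hLc : Continuous (sumSq b h) := (contDiff_sumSq b hh).continuous
  have hL : HasCompactSupport (sumSq b h) := hasCompactSupport_sumSq b hc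
  have hkey := fun n => integral_regularized_mul_sumSq b hh hc (hεpos n)
  have hlhs : Filter.Tendsto (fun n => ∫ x : E,
      (‖x‖ ^ 2 + ε n ^ 2) ^ ((2 - (Module.finrank ℝ E : ℝ)) / 2) * sumSq b h x) Filter.atTop
      (nhds (∫ x : E, ‖x‖ ^ (2 - (Module.finrank ℝ E : ℝ)) * sumSq b h x)) := by
    have hpow : ∀ x : E, ‖x‖ ^ (2 - (Module.finrank ℝ E : ℝ))
        = (‖x‖ ^ 2) ^ ((2 - (Module.finrank ℝ E : ℝ)) / 2) := fun x => by
      rw [← Real.rpow_natCast, ← Real.rpow_mul (norm_nonneg _)]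
      congr 1; push_cast; ring
    have hint : Integrable fun x : E => ‖x‖ ^ (2 - (Module.finrank ℝ E : ℝ)) * ‖sumSq b h x‖ := by
      have := (locallyIntegrable_norm_rpow (E := E) (s := 2 - (Module.finrank ℝ E : ℝ))
        (by omega) (by linarith)).integrable_smul_left_of_hasCompactSupport hLc.norm hL.norm
      simpa [mul_comm] using this
    have hne : ∀ᵐ x : E, x ≠ 0 := by
      have : Nontrivial E := Module.nontrivial_of_finrank_pos (R := ℝ) (by omega)
      exact Measure.ae_ne volume 0
    refine tendsto_integral_of_dominated_convergence _ (fun n => ?_) hint (fun n => ?_) ?_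
    · exact (Measurable.mul (by fun_prop) hLc.measurable).aestronglyMeasurable
    · filter_upwards [hne] with x hx
      have hx' : 0 < ‖x‖ := norm_pos_iff.mpr hx
      rw [norm_mul, Real.norm_of_nonneg (by positivity), hpow]
      refine mul_le_mul_of_nonneg_right ?_ (norm_nonneg _)
      exact Real.rpow_le_rpow_of_nonpos (by positivity) (by nlinarith [hεpos n]) (by linarith)
    · filter_upwards [hne] with x hx
      have hx' : 0 < ‖x‖ := norm_pos_iff.mpr hx
      refine Filter.Tendsto.mul_const _ ?_
      rw [hpow]
      refine Filter.Tendsto.rpow_const ?_ (Or.inl (by positivity))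
      simpa using (hε0.pow 2).const_add (‖x‖ ^ 2)
  have hrhs : Filter.Tendsto (fun n => ∫ z : E,
      -(((Module.finrank ℝ E : ℝ) - 2) * Module.finrank ℝ E)
        * ((1 + ‖z‖ ^ 2) ^ (-((Module.finrank ℝ E : ℝ) + 2) / 2) * h (ε n • z))) Filter.atTop
      (nhds (∫ z : E, -(((Module.finrank ℝ E : ℝ) - 2) * Module.finrank ℝ E)
        * ((1 + ‖z‖ ^ 2) ^ (-((Module.finrank ℝ E : ℝ) + 2) / 2) * h 0))) := by
    obtain ⟨C, hC⟩ := hc.exists_bound_of_continuous hh.continuous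
    have hint : Integrable fun z : E => (1 + ‖z‖ ^ 2) ^ (-((Module.finrank ℝ E : ℝ) + 2) / 2) :=
      integrable_rpow_neg_one_add_norm_sq (by linarith)
    refine tendsto_integral_of_dominated_convergence
      (fun z => ‖-(((Module.finrank ℝ E : ℝ) - 2) * Module.finrank ℝ E)‖
        * ((1 + ‖z‖ ^ 2) ^ (-((Module.finrank ℝ E : ℝ) + 2) / 2) * C)) (fun n => ?_)
      ((hint.mul_const C).const_mul _) (fun n => ?_) ?_
    · have := hh.continuous
      exact Measurable.aestronglyMeasurable (by fun_prop)
    · refine Filter.Eventually.of_forall fun z => ?_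
      have hnn : 0 ≤ (1 + ‖z‖ ^ 2) ^ (-((Module.finrank ℝ E : ℝ) + 2) / 2) := by positivity
      rw [norm_mul, norm_mul, Real.norm_of_nonneg hnn]
      gcongr
      exact hC _
    · refine Filter.Eventually.of_forall fun z => ?_
      refine ((?_ : Filter.Tendsto _ _ _).const_mul _).const_mul _
      have : Filter.Tendsto (fun n => ε n • z) Filter.atTop (nhds 0) := by
        simpa using hε0.smul_const z
      exact (hh.continuous.tendsto 0).comp this
  simp only [hkey] at hlhs
  rw [tendsto_nhds_unique hlhs hrhs, MeasureTheory.integral_const_mul,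
    MeasureTheory.integral_mul_const, newtonConst]
  ring

/-- `-‖x - y‖ ^ (2 - M) / newtonConst` is the fundamental solution of the Laplacian. -/
lemma integral_norm_sub_rpow_mul_sumSq (hM : 3 ≤ Module.finrank ℝ E)
    (b : OrthonormalBasis (Fin (Module.finrank ℝ E)) ℝ E)
    {h : E → ℝ} (hh : ContDiff ℝ ∞ h) (hc : HasCompactSupport h) (y : E) :
    ∫ x : E, ‖x - y‖ ^ (2 - (Module.finrank ℝ E : ℝ)) * sumSq b h x = -(newtonConst E * h y) := by
  have h1 := integral_norm_rpow_mul_sumSq hM b (h := fun z => h (z + y))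
    (hh.comp (contDiff_id.add contDiff_const)) (hc.comp_homeomorph (Homeomorph.addRight y))
  rw [zero_add] at h1
  rw [← h1, ← integral_sub_right_eq_self
    (fun x => ‖x‖ ^ (2 - (Module.finrank ℝ E : ℝ)) * sumSq b (fun z => h (z + y)) x) y]
  refine integral_congr_ae (Filter.Eventually.of_forall fun x => ?_)
  simp only [sumSq_comp_add_right, sub_add_cancel]

end FundamentalSolution

/-- The explicit formula makes the smooth dependence of the reflection on `v ≠ 0` visible. -/
lemma reflection_orthogonal_singleton_apply {E : Type*} [NormedAddCommGroup E]
    [InnerProductSpace ℝ E] (v z : E) :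
    (ℝ ∙ v)ᗮ.reflection z = z - (2 * (inner ℝ v z / ‖v‖ ^ 2)) • v := by
  rw [Submodule.reflection_orthogonal_apply, Submodule.reflection_singleton_apply]
  simp only [RCLike.ofReal_real_eq_id, id_eq, neg_sub, two_smul, two_mul, add_smul]

/-! ### Convergence and scaling of the Newtonian potential. -/

section NewtonPotential

variable {E : Type*} [NormedAddCommGroup E] [InnerProductSpace ℝ E] [FiniteDimensional ℝ E]
  [MeasurableSpace E] [BorelSpace E]

local notation "dimE" => (Module.finrank ℝ E : ℝ)

/-- Near `0` the singularity is integrable because `α - 2 > -M`, near `x` because `2 - M > -M`, and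
at infinity the product decays like `‖y‖ ^ (α - M)` with `α < 0`. These are the only constraints on
`α`. -/
lemma integrable_kernel_mul_norm_rpow (hM : 3 ≤ Module.finrank ℝ E) {α : ℝ} (hα : α < 0)
    (hα' : 2 - dimE < α) {x : E} (hx : x ≠ 0) :
    Integrable fun y : E => ‖x - y‖ ^ (2 - dimE) * ‖y‖ ^ (α - 2) := by
  have hM' : (3 : ℝ) ≤ dimE := by exact_mod_cast hM
  have hn : 0 < ‖x‖ := norm_pos_iff.mpr hx
  obtain ⟨r, hr⟩ : ∃ r, r = ‖x‖ / 2 := ⟨_, rfl⟩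
  have hrpos : 0 < r := by rw [hr]; positivity
  have hmeas : AEStronglyMeasurable (fun y : E => ‖x - y‖ ^ (2 - dimE) * ‖y‖ ^ (α - 2)) :=
    Measurable.aestronglyMeasurable (by fun_prop)
  have hnorm : ∀ y : E, ‖‖x - y‖ ^ (2 - dimE) * ‖y‖ ^ (α - 2)‖
      = ‖x - y‖ ^ (2 - dimE) * ‖y‖ ^ (α - 2) := fun y => Real.norm_of_nonneg (by positivity)
  have htri : ∀ y : E, ‖x‖ ≤ ‖x - y‖ + ‖y‖ := fun y => by
    simpa using norm_add_le (x - y) y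
  have h0 : IntegrableOn (fun y : E => ‖x - y‖ ^ (2 - dimE) * ‖y‖ ^ (α - 2))
      (Metric.closedBall (0 : E) r) := by
    have hl := (locallyIntegrable_norm_rpow (E := E) (s := α - 2) (by omega) (by linarith)
      |>.integrableOn_isCompact (isCompact_closedBall 0 r)).const_mul (r ^ (2 - dimE))
    refine hl.mono' hmeas.restrict (ae_restrict_of_forall_mem measurableSet_closedBall
      fun y hy => ?_)
    rw [mem_closedBall_zero_iff] at hy
    rw [hnorm]
    refine mul_le_mul_of_nonneg_right ?_ (by positivity)
    exact Real.rpow_le_rpow_of_nonpos hrpos (by linarith [htri y]) (by linarith)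
  have h1 : IntegrableOn (fun y : E => ‖x - y‖ ^ (2 - dimE) * ‖y‖ ^ (α - 2))
      (Metric.closedBall x r) := by
    have hl : IntegrableOn (fun y : E => ‖x - y‖ ^ (2 - dimE)) (Metric.closedBall x r) := by
      have hl' := (locallyIntegrable_norm_rpow (E := E) (s := 2 - dimE) (by omega) (by linarith)
        |>.integrableOn_isCompact (isCompact_closedBall 0 r))
      rw [← integrable_indicator_iff measurableSet_closedBall] at hl' ⊢
      refine (hl'.comp_sub_left x).congr (Filter.Eventually.of_forall fun y => ?_)
      have : x - y ∈ Metric.closedBall (0 : E) r ↔ y ∈ Metric.closedBall x r := by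
        rw [mem_closedBall_zero_iff, mem_closedBall_iff_norm']
      beta_reduce
      by_cases hy : y ∈ Metric.closedBall x r
      · rw [Set.indicator_of_mem (this.mpr hy), Set.indicator_of_mem hy]
      · rw [Set.indicator_of_notMem (this.not.mpr hy), Set.indicator_of_notMem hy]
    refine (hl.mul_const (r ^ (α - 2))).mono' hmeas.restrict
      (ae_restrict_of_forall_mem measurableSet_closedBall fun y hy => ?_)
    rw [mem_closedBall_iff_norm'] at hy
    rw [hnorm]
    refine mul_le_mul_of_nonneg_left ?_ (by positivity)
    exact Real.rpow_le_rpow_of_nonpos hrpos (by linarith [htri y]) (by linarith)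
  have h2 : IntegrableOn (fun y : E => ‖x - y‖ ^ (2 - dimE) * ‖y‖ ^ (α - 2))
      (Metric.closedBall 0 r ∪ Metric.closedBall x r)ᶜ := by
    have hl : Integrable fun y : E => (1 + ‖y‖) ^ (-(dimE - α)) :=
      integrable_one_add_norm (by linarith)
    -- Off both balls `1 ≤ ‖y‖ / r`, and `‖x‖ = 2 r < 2 ‖x - y‖` gives `‖y‖ ≤ 3 ‖x - y‖`. Hence `1 +
    -- ‖y‖` is at most `c` times either norm.
    set c : ℝ := 3 * (1 / r + 1) with hc
    have hcpos : 0 < c := by positivity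
    refine (hl.const_mul (c⁻¹ ^ (-(dimE - α)))).integrableOn.mono' hmeas.restrict
      (ae_restrict_of_forall_mem
        (measurableSet_closedBall.union measurableSet_closedBall).compl fun y hy => ?_)
    rw [Set.mem_compl_iff, Set.mem_union, not_or, mem_closedBall_zero_iff, mem_closedBall_iff_norm',
      not_le, not_le] at hy
    have hy1 : (1 + ‖y‖) ≤ c * ‖y‖ := by
      have : 1 ≤ 1 / r * ‖y‖ := by rw [one_div_mul_eq_div, one_le_div hrpos]; exact hy.1.le
      rw [hc]; nlinarith [norm_nonneg y]
    have hy2 : (1 + ‖y‖) ≤ c * ‖x - y‖ := by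
      have h3 : ‖y‖ ≤ 3 * ‖x - y‖ := by
        have : ‖y‖ ≤ ‖x - y‖ + ‖x‖ := by
          have := norm_sub_le x (x - y); rw [sub_sub_cancel] at this; linarith
        linarith [hy.2]
      have : (1 / r + 1) * ‖y‖ ≤ c * ‖x - y‖ := by
        rw [hc]; nlinarith [show 0 < 1 / r + 1 by positivity]
      have : 1 ≤ 1 / r * ‖y‖ := by rw [one_div_mul_eq_div, one_le_div hrpos]; exact hy.1.le
      linarith
    have ha : 0 < c⁻¹ * (1 + ‖y‖) := by positivity
    have hb1 : c⁻¹ * (1 + ‖y‖) ≤ ‖y‖ := by rw [inv_mul_le_iff₀ hcpos]; exact hy1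
    have hb2 : c⁻¹ * (1 + ‖y‖) ≤ ‖x - y‖ := by rw [inv_mul_le_iff₀ hcpos]; exact hy2
    rw [hnorm, ← Real.mul_rpow (by positivity) (by positivity),
      show -(dimE - α) = (2 - dimE) + (α - 2) by ring, Real.rpow_add ha]
    gcongr ?_ * ?_
    · exact Real.rpow_le_rpow_of_nonpos ha hb2 (by linarith)
    · exact Real.rpow_le_rpow_of_nonpos ha hb1 (by linarith)
  have := (h0.union h1).union h2
  rwa [Set.union_compl_self, integrableOn_univ] at this

section Bounds

variable {β : ℝ} {G : ℝ × E → ℝ}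

omit [MeasurableSpace E] [BorelSpace E] in
lemma IsHomog.exists_bound (hG : IsHomog β G) (u : ℝ) :
    ∃ C : ℝ, ∀ y : E, y ≠ 0 → ‖G (u, y)‖ ≤ C * ‖y‖ ^ β := by
  obtain ⟨C, hC⟩ := (isCompact_sphere (0 : E) 1).exists_bound_of_continuousOn
    ((hG.continuousOn_slice u).mono fun y hy => ne_zero_of_mem_sphere_one hy)
  refine ⟨C, fun y hy => ?_⟩
  rw [hG.eq_norm_rpow_mul u hy, norm_mul, Real.norm_of_nonneg (by positivity), mul_comm]
  exact mul_le_mul_of_nonneg_right (hC _ (inv_norm_smul_mem_sphere hy)) (by positivity)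

lemma ae_ne_zero (hM : 3 ≤ Module.finrank ℝ E) : ∀ᵐ y : E, y ≠ 0 := by
  have : Nontrivial E := Module.nontrivial_of_finrank_pos (R := ℝ) (by omega)
  exact Measure.ae_ne volume 0

lemma IsHomog.aestronglyMeasurable_slice (hM : 3 ≤ Module.finrank ℝ E) (hG : IsHomog β G)
    (u : ℝ) : AEStronglyMeasurable (fun y => G (u, y)) := by
  have hopen : IsOpen {y : E | y ≠ 0} := isOpen_ne
  have := (hG.continuousOn_slice u).aestronglyMeasurable (μ := volume) hopen.measurableSet
  rwa [Measure.restrict_eq_self_of_ae_mem (s := {y : E | y ≠ 0}) (ae_ne_zero hM)] at this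

end Bounds

/-- The Newtonian potential, up to normalisation, in the second variable. -/
noncomputable def newtonPotential (G : ℝ × E → ℝ) (p : ℝ × E) : ℝ :=
  ∫ y : E, ‖p.2 - y‖ ^ (2 - dimE) * G (p.1, y)

variable {α : ℝ} {G : ℝ × E → ℝ}

lemma IsHomog.integrable_kernel_mul (hM : 3 ≤ Module.finrank ℝ E) (hα : α < 0)
    (hα' : 2 - dimE < α) (hG : IsHomog (α - 2) G) (u : ℝ) {x : E} (hx : x ≠ 0) :
    Integrable fun y : E => ‖x - y‖ ^ (2 - dimE) * G (u, y) := by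
  obtain ⟨C, hC⟩ := hG.exists_bound u
  refine ((integrable_kernel_mul_norm_rpow hM hα hα' hx).const_mul C).mono'
    (AEStronglyMeasurable.mul (Measurable.aestronglyMeasurable (by fun_prop))
      (hG.aestronglyMeasurable_slice hM u)) ?_
  filter_upwards [ae_ne_zero hM] with y hy
  rw [norm_mul, Real.norm_of_nonneg (by positivity)]
  calc _ ≤ ‖x - y‖ ^ (2 - dimE) * (C * ‖y‖ ^ (α - 2)) :=
        mul_le_mul_of_nonneg_left (hC y hy) (by positivity)
    _ = _ := by ring

/-- Change of variables under a similarity of the space. -/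
lemma IsHomog.newtonPotential_similarity (hM : 3 ≤ Module.finrank ℝ E)
    (hG : IsHomog (α - 2) G) (u : ℝ) (x : E) {r : ℝ} (hr : 0 < r) (R : E ≃ₗᵢ[ℝ] E) :
    newtonPotential G (u, r • R x)
      = r ^ α * ∫ z : E, ‖x - z‖ ^ (2 - dimE) * G (u, R z) := by
  set f : E → ℝ := fun y => ‖r • R x - y‖ ^ (2 - dimE) * G (u, y) with hf
  have h1 := Measure.integral_comp_smul (volume : Measure E) f r
  have hrM : 0 < r ^ Module.finrank ℝ E := by positivity
  rw [abs_of_pos (by positivity), smul_eq_mul, eq_inv_mul_iff_mul_eq₀ hrM.ne'] at h1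
  have h2 := R.measurePreserving.integral_comp R.toHomeomorph.measurableEmbedding
    fun y => f (r • y)
  change ∫ y, f y = _
  rw [← h1, ← h2, ← MeasureTheory.integral_const_mul, ← MeasureTheory.integral_const_mul]
  refine integral_congr_ae ?_
  filter_upwards [ae_ne_zero hM] with z hz
  have hRz : R z ≠ 0 := by simpa using hz
  simp only [hf]
  rw [← smul_sub, ← map_sub, norm_smul, R.norm_map, Real.norm_of_nonneg hr.le,
    hG.homog u _ _ hRz hr, Real.mul_rpow hr.le (norm_nonneg _)]
  -- The three factors come from the volume element, the kernel and the homogeneity of `G`.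
  have : r ^ α = r ^ Module.finrank ℝ E * r ^ (2 - dimE) * r ^ (α - 2) := by
    rw [← Real.rpow_natCast, ← Real.rpow_add hr, ← Real.rpow_add hr]; congr 1; ring
  rw [this]; ring

lemma IsHomog.newtonPotential_smul (hM : 3 ≤ Module.finrank ℝ E)
    (hG : IsHomog (α - 2) G) (u : ℝ) (x : E) {r : ℝ} (hr : 0 < r) :
    newtonPotential G (u, r • x) = r ^ α * newtonPotential G (u, x) :=
  hG.newtonPotential_similarity hM u x hr (LinearIsometryEquiv.refl ℝ E)

end NewtonPotential

/-! ### Smoothness of the potential and Poisson's equation. -/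

section Smoothness

variable {E : Type} [NormedAddCommGroup E] [InnerProductSpace ℝ E] [FiniteDimensional ℝ E]
  [MeasurableSpace E] [BorelSpace E]

local notation "dimE" => (Module.finrank ℝ E : ℝ)

variable {α : ℝ} {G : ℝ × E → ℝ}

/-- Weighted integrals over the space that only depend on directions are integrals over the
sphere. -/
lemma exists_measure_sphere (hM : 3 ≤ Module.finrank ℝ E) {w : E → ℝ} (hw : Integrable w)
    (hw0 : ∀ y, 0 ≤ w y) (hwm : Measurable w) :
    ∃ μ : Measure E, μ (Metric.sphere 0 1) ≠ ⊤ ∧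
      ∀ f : E → ℝ, ContinuousOn f (Metric.sphere 0 1) →
        ∫ y, w y * f (‖y‖⁻¹ • y) = ∫ y in Metric.sphere 0 1, f y ∂μ := by
  set κ : E → E := fun y => ‖y‖⁻¹ • y with hκ
  have hκm : Measurable κ := by fun_prop
  -- The measure sought is the pushforward of `w dy` under radial projection.
  set ν : Measure E := volume.withDensity fun y => ENNReal.ofReal (w y) with hν
  have hνfin : IsFiniteMeasure ν := isFiniteMeasure_withDensity_ofReal hw.2
  have hmem : ∀ᵐ y ∂(ν.map κ), y ∈ Metric.sphere (0 : E) 1 := by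
    refine (ae_map_iff (p := fun y => y ∈ Metric.sphere (0 : E) 1) hκm.aemeasurable
      Metric.isClosed_sphere.measurableSet).mpr ?_
    refine (withDensity_absolutelyContinuous _ _).ae_le ?_
    filter_upwards [ae_ne_zero hM] with y hy using inv_norm_smul_mem_sphere hy
  refine ⟨ν.map κ, measure_ne_top _ _, fun f hf => ?_⟩
  have hfm := hf.aestronglyMeasurable_of_isCompact (μ := ν.map κ) (isCompact_sphere 0 1)
    Metric.isClosed_sphere.measurableSet
  rw [Measure.restrict_eq_self_of_ae_mem hmem] at hfm ⊢
  rw [integral_map hκm.aemeasurable hfm, hν,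
    integral_withDensity_eq_integral_toReal_smul (by fun_prop) (by simp)]
  simp [ENNReal.toReal_ofReal (hw0 _), hκ]

/-- The kernel is singular at `y = x`, so differentiating under the integral directly is not
possible. Writing `x = ‖x‖ R x₁` with `x₁` a fixed unit vector and `R` a reflection, a change of
variables moves all dependence on `x` into `G (u, R z)` and leaves a fixed integrable weight. By
homogeneity of `G` only the direction of `z` matters, so the integral becomes one over the unit
sphere, where the integrand is smooth in the parameters. -/
lemma IsHomog.contDiffOn_newtonPotential (hM : 3 ≤ Module.finrank ℝ E) (hα : α < 0)
    (hα' : 2 - dimE < α) (hG : IsHomog (α - 2) G) :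
    ContDiffOn ℝ ∞ (newtonPotential G) (puncturedSpace E) := by
  rintro ⟨u₀, x₀⟩ hx₀
  have hx₀' : x₀ ≠ 0 := hx₀
  refine ContDiffAt.contDiffWithinAt ?_
  set K : Set E := Metric.sphere 0 1 with hK
  -- Taking the antipode keeps `x₁ - x / ‖x‖`, the normal of the reflecting hyperplane, away from
  -- zero for `x` near `x₀`.
  set x₁ : E := -(‖x₀‖⁻¹ • x₀) with hx₁
  have hx₁n : ‖x₁‖ = 1 := by
    have := inv_norm_smul_mem_sphere hx₀'; rw [mem_sphere_zero_iff_norm] at this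
    rw [hx₁, norm_neg, this]
  have hx₁0 : x₁ ≠ 0 := by rintro h; simp [h] at hx₁n
  set w : E → ℝ := fun z => ‖x₁ - z‖ ^ (2 - dimE) * ‖z‖ ^ (α - 2) with hw
  obtain ⟨μ, hμ, hμint⟩ := exists_measure_sphere hM (integrable_kernel_mul_norm_rpow hM hα hα' hx₁0)
    (w := w) (fun y => by positivity) (by fun_prop)
  -- the reflection taking `x₁` to the direction of `x`
  set v : (ℝ × E) × E → E := fun q => x₁ - ‖q.1.2‖⁻¹ • q.1.2 with hv
  set ρ : (ℝ × E) × E → E := fun q => q.2 - (2 * (inner ℝ (v q) q.2 / ‖v q‖ ^ 2)) • v q with hρ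
  set W₀ : Set ((ℝ × E) × E) := {q | q.1.2 ≠ 0} with hW₀
  have hW₀o : IsOpen W₀ := isOpen_ne.preimage (by fun_prop)
  have hvs : ContDiffOn ℝ ∞ v W₀ := by
    have h1 : ContDiffOn ℝ ∞ (fun q : (ℝ × E) × E => q.1.2) W₀ :=
      (contDiff_snd.comp contDiff_fst).contDiffOn
    exact contDiffOn_const.sub (((h1.norm ℝ fun q hq => hq).inv
      fun q hq => norm_ne_zero_iff.mpr hq).smul h1)
  set W₁ : Set ((ℝ × E) × E) := W₀ ∩ v ⁻¹' {a | a ≠ 0} with hW₁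
  have hW₁o : IsOpen W₁ := hvs.continuousOn.isOpen_inter_preimage hW₀o isOpen_ne
  have hvs₁ := hvs.mono (Set.inter_subset_left (s := W₀) (t := v ⁻¹' {a | a ≠ 0}))
  have hρs : ContDiffOn ℝ ∞ ρ W₁ := by
    refine contDiff_snd.contDiffOn.sub (ContDiffOn.smul (contDiffOn_const.mul ?_) hvs₁)
    exact (hvs₁.inner ℝ contDiff_snd.contDiffOn).div (hvs₁.norm_sq ℝ)
      fun q hq => pow_ne_zero 2 (norm_ne_zero_iff.mpr hq.2)
  set W : Set ((ℝ × E) × E) := W₁ ∩ ρ ⁻¹' {a | a ≠ 0} with hW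
  have hWo : IsOpen W := hρs.continuousOn.isOpen_inter_preimage hW₁o isOpen_ne
  have hΨ : ContDiffOn ℝ ∞ (fun q : (ℝ × E) × E => G (q.1.1, ρ q)) W :=
    hG.smooth.comp ((contDiff_fst.comp contDiff_fst).contDiffOn.prodMk
      (hρs.mono Set.inter_subset_left)) fun q hq => hq.2
  have hmain := contDiffOn_setIntegral_of_isCompact (isCompact_sphere (0 : E) 1) hWo hμ hΨ
  have hρeq : ∀ p : ℝ × E, ∀ z, ρ (p, z) = (ℝ ∙ (x₁ - ‖p.2‖⁻¹ • p.2))ᗮ.reflection z := fun p z =>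
    (reflection_orthogonal_singleton_apply _ _).symm
  have hWmem : ∀ p : ℝ × E, p.2 ≠ 0 → x₁ - ‖p.2‖⁻¹ • p.2 ≠ 0 → ∀ z ∈ K, (p, z) ∈ W :=
    fun p hp hp' z hz => ⟨⟨hp, hp'⟩, by
      have : z ≠ 0 := ne_zero_of_mem_sphere_one hz
      simp only [Set.mem_preimage, hρeq]
      simpa using this⟩
  have hU := isOpen_forall_mem_of_isCompact (isCompact_sphere (0 : E) 1) hWo
  have hp₀ : x₁ - ‖x₀‖⁻¹ • x₀ ≠ 0 := by
    rw [hx₁, ← neg_add', neg_ne_zero, ← two_smul ℝ]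
    exact smul_ne_zero two_ne_zero (ne_zero_of_mem_sphere_one (inv_norm_smul_mem_sphere hx₀'))
  have hU₀ : (u₀, x₀) ∈ {p : ℝ × E | ∀ z ∈ K, (p, z) ∈ W} := hWmem _ hx₀' hp₀
  have hprod : ContDiffAt ℝ ∞ (fun p : ℝ × E => ‖p.2‖ ^ α * ∫ z in K, G (p.1, ρ (p, z)) ∂μ)
      (u₀, x₀) := by
    refine ContDiffAt.mul ?_ (hmain.contDiffAt (hU.mem_nhds hU₀))
    exact (contDiffAt_snd.norm ℝ hx₀').rpow_const_of_ne (norm_ne_zero_iff.mpr hx₀')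
  refine hprod.congr_of_eventuallyEq ?_
  have hnear : (W₁.preimage fun p : ℝ × E => (p, (0 : E))) ∈ nhds (u₀, x₀) :=
    (hW₁o.preimage (by fun_prop)).mem_nhds ⟨hx₀', hp₀⟩
  filter_upwards [hnear] with p hp
  have hp2 : p.2 ≠ 0 := hp.1
  have hp3 : x₁ - ‖p.2‖⁻¹ • p.2 ≠ 0 := hp.2
  have hpn : 0 < ‖p.2‖ := norm_pos_iff.mpr hp2
  set R := (ℝ ∙ (x₁ - ‖p.2‖⁻¹ • p.2))ᗮ.reflection with hR
  have hRx : R x₁ = ‖p.2‖⁻¹ • p.2 := Submodule.reflection_sub (by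
    have := inv_norm_smul_mem_sphere hp2; rw [mem_sphere_zero_iff_norm] at this
    rw [this, hx₁n])
  have hpe : p = (p.1, ‖p.2‖ • R x₁) := by
    rw [hRx, smul_smul, mul_inv_cancel₀ hpn.ne', one_smul]
  conv_lhs => rw [hpe]
  rw [hG.newtonPotential_similarity hM p.1 x₁ hpn R, ← hμint (fun z => G (p.1, ρ (p, z)))]
  · congr 1
    refine integral_congr_ae ?_
    filter_upwards [ae_ne_zero hM] with z hz
    have hz' : 0 < ‖z‖ := norm_pos_iff.mpr hz
    have hRz : R z ≠ 0 := by simpa using hz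
    simp only [hw, hρeq]
    rw [hG.eq_norm_rpow_mul p.1 hRz, R.norm_map, map_smul]
    ring
  · exact hΨ.continuousOn.comp (by fun_prop) fun z hz => hWmem p hp2 hp3 z hz

lemma IsHomog.isHomog_newtonPotential (hM : 3 ≤ Module.finrank ℝ E) (hα : α < 0)
    (hα' : 2 - dimE < α) (hG : IsHomog (α - 2) G) : IsHomog α (newtonPotential G) where
  smooth := hG.contDiffOn_newtonPotential hM hα hα'
  homog u y _ _ ht := hG.newtonPotential_smul hM u y ht

/-- The Newtonian potential solves Poisson's equation in the weak sense. -/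
lemma IsHomog.integral_newtonPotential_mul_sumSq (hM : 3 ≤ Module.finrank ℝ E) (hα : α < 0)
    (hα' : 2 - dimE < α) (hG : IsHomog (α - 2) G) (u : ℝ)
    (b : OrthonormalBasis (Fin (Module.finrank ℝ E)) ℝ E) {h : E → ℝ} (hh : ContDiff ℝ ∞ h)
    (hc : HasCompactSupport h) (hs : tsupport h ⊆ {x | x ≠ 0}) :
    ∫ x, newtonPotential G (u, x) * sumSq b h x = -(newtonConst E * ∫ y, G (u, y) * h y) := by
  have hLc : Continuous (sumSq b h) := (contDiff_sumSq b hh).continuous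
  have hL : HasCompactSupport (sumSq b h) := hasCompactSupport_sumSq b hc
  have hLs : tsupport (sumSq b h) ⊆ {x | x ≠ 0} := (tsupport_sumSq_subset b h).trans hs
  set Φ : E → E → ℝ := fun x y => ‖x - y‖ ^ (2 - dimE) * G (u, y) * sumSq b h x with hΦ
  have hmeas : AEStronglyMeasurable (Function.uncurry Φ) (volume.prod volume) := by
    refine AEStronglyMeasurable.mul (AEStronglyMeasurable.mul ?_
      (hG.aestronglyMeasurable_slice hM u).comp_snd) ?_
    · exact Measurable.aestronglyMeasurable (by fun_prop)
    · exact (hLc.comp continuous_fst).aestronglyMeasurable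
  obtain ⟨C, hC⟩ := hG.exists_bound u
  -- The potential of this pure power is already known to be continuous off the origin. It serves as
  -- majorant of the inner integrals in the Fubini argument.
  have hN : IsHomog (α - 2) fun p : ℝ × E => (‖p.2‖ ^ 2 + 0) ^ ((α - 2) / 2) :=
    IsHomog.norm_rpow (α - 2)
  have hprod : Integrable (Function.uncurry Φ) (volume.prod volume) := by
    rw [integrable_prod_iff hmeas]
    refine ⟨?_, ?_⟩
    · filter_upwards [ae_ne_zero hM] with x hx
      exact (hG.integrable_kernel_mul hM hα hα' u hx).mul_const (sumSq b h x)
    · have hI := integrable_mul_of_tsupport_subset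
        (f := fun x => C * newtonPotential (fun p : ℝ × E => (‖p.2‖ ^ 2 + 0) ^ ((α - 2) / 2)) (u, x))
        (continuousOn_const.mul ((hN.isHomog_newtonPotential hM hα hα').continuousOn_slice u))
        hLc.norm hL.norm (by
          have : tsupport (fun x => ‖sumSq b h x‖) = tsupport (sumSq b h) := by
            unfold tsupport; congr 1; ext x; simp
          rw [this]; exact hLs)
      refine hI.mono' hmeas.norm.integral_prod_right' ?_
      filter_upwards [ae_ne_zero hM] with x hx
      rw [Real.norm_of_nonneg (by positivity)]
      have : (fun y => ‖Function.uncurry Φ (x, y)‖)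
          = fun y => ‖‖x - y‖ ^ (2 - dimE) * G (u, y)‖ * ‖sumSq b h x‖ := by
        ext y; simp only [Function.uncurry, hΦ, norm_mul]
      rw [this, MeasureTheory.integral_mul_const]
      refine mul_le_mul_of_nonneg_right ?_ (norm_nonneg _)
      rw [newtonPotential, ← MeasureTheory.integral_const_mul]
      refine integral_mono_ae (hG.integrable_kernel_mul hM hα hα' u hx).norm
        ((hN.integrable_kernel_mul hM hα hα' u hx).const_mul C) ?_
      filter_upwards [ae_ne_zero hM] with y hy
      have hpow : (‖y‖ ^ 2 + 0) ^ ((α - 2) / 2) = ‖y‖ ^ (α - 2) := by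
        rw [add_zero, ← Real.rpow_natCast, ← Real.rpow_mul (norm_nonneg _)]
        congr 1; push_cast; ring
      rw [norm_mul, Real.norm_of_nonneg (by positivity), hpow]
      calc _ ≤ ‖x - y‖ ^ (2 - dimE) * (C * ‖y‖ ^ (α - 2)) :=
            mul_le_mul_of_nonneg_left (hC y hy) (by positivity)
        _ = _ := by ring
  calc ∫ x, newtonPotential G (u, x) * sumSq b h x = ∫ x, ∫ y, Φ x y := by
        refine integral_congr_ae (Filter.Eventually.of_forall fun x => ?_)
        simp only [newtonPotential, hΦ, MeasureTheory.integral_mul_const]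
    _ = ∫ y, ∫ x, Φ x y := integral_integral_swap hprod
    _ = ∫ y, G (u, y) * -(newtonConst E * h y) := by
        refine integral_congr_ae (Filter.Eventually.of_forall fun y => ?_)
        simp only []
        rw [← integral_norm_sub_rpow_mul_sumSq hM b hh hc y, ← MeasureTheory.integral_const_mul]
        refine integral_congr_ae (Filter.Eventually.of_forall fun x => ?_)
        simp only [hΦ]; ring
    _ = _ := by
        rw [← MeasureTheory.integral_const_mul, ← MeasureTheory.integral_neg]
        refine integral_congr_ae (Filter.Eventually.of_forall fun y => ?_)
        simp only []; ring

/-- The weak equation upgrades to a pointwise one: the difference of the two sides is continuous off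
the origin and integrates to zero against every test function supported there. -/
lemma IsHomog.fiberLaplacian_newtonPotential (hM : 3 ≤ Module.finrank ℝ E) (hα : α < 0)
    (hα' : 2 - dimE < α) (hG : IsHomog (α - 2) G) {p : ℝ × E} (hp : p ∈ puncturedSpace E) :
    fiberLaplacian (newtonPotential G) p = -(newtonConst E * G p) := by
  obtain ⟨u, x⟩ := p
  have hN := hG.isHomog_newtonPotential hM hα hα'
  have hL := hN.isHomog_fiberLaplacian
  have hU : IsOpen {x : E | x ≠ 0} := isOpen_ne
  set b := stdOrthonormalBasis ℝ E with hb
  have hf : ContDiffOn ℝ ∞ (fun x => newtonPotential G (u, x)) {x : E | x ≠ 0} :=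
    hN.smooth.comp (contDiff_const.prodMk contDiff_id).contDiffOn fun x hx => hx
  have hslice : ∀ x : E, x ≠ 0 →
      sumSq b (fun x => newtonPotential G (u, x)) x = fiberLaplacian (newtonPotential G) (u, x) :=
    fun x hx => by
      rw [← laplacian_eq_sumSq b ((hf.contDiffAt (hU.mem_nhds hx)).of_le two_le_smooth),
        laplacian_slice b isOpen_puncturedSpace hN.smooth hx]
      rfl
  have hcont : ContinuousOn
      (fun x => fiberLaplacian (newtonPotential G) (u, x) + newtonConst E * G (u, x))
      {x : E | x ≠ 0} :=
    (hL.continuousOn_slice u).add (continuousOn_const.mul (hG.continuousOn_slice u))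
  have hae := hU.ae_eq_zero_of_integral_contDiff_smul_eq_zero (μ := volume)
    (hcont.locallyIntegrableOn hU.measurableSet) fun h hh hc hs => by
      have h1 := hG.integral_newtonPotential_mul_sumSq hM hα hα' u b hh hc hs
      rw [integral_mul_sumSq b hU hf hh hc hs] at h1
      have h2 : ∫ x, sumSq b (fun x => newtonPotential G (u, x)) x * h x
          = ∫ x, fiberLaplacian (newtonPotential G) (u, x) * h x := by
        refine integral_congr_ae ?_
        filter_upwards [ae_ne_zero hM] with x hx
        rw [hslice x hx]
      have i1 := integrable_mul_of_tsupport_subset (hL.continuousOn_slice u) hh.continuous hc hs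
      have i2 := integrable_mul_of_tsupport_subset (hG.continuousOn_slice u) hh.continuous hc hs
      have : (fun x => h x • (fiberLaplacian (newtonPotential G) (u, x) + newtonConst E * G (u, x)))
          = fun x => fiberLaplacian (newtonPotential G) (u, x) * h x
            + newtonConst E * (G (u, x) * h x) := by
        ext x; simp only [smul_eq_mul]; ring
      rw [this, integral_add i1 (i2.const_mul _), MeasureTheory.integral_const_mul, ← h2, h1]
      ring
  have hEq := Measure.eqOn_open_of_ae_eq (g := fun _ => (0 : ℝ))
    ((ae_restrict_iff' hU.measurableSet).mpr hae) hU hcont continuousOn_const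
  have := hEq (x := x) hp
  simp only at this
  linarith

lemma poissonSolvable_of_neg (hM : 3 ≤ Module.finrank ℝ E) (hα : α < 0) (hα' : 2 - dimE < α) :
    PoissonSolvable E α := fun G hG => by
  refine ⟨_, (hG.isHomog_newtonPotential hM hα hα').const_mul (-(newtonConst E)⁻¹), fun p hp => ?_⟩
  rw [fiberLaplacian, sumSq_const_mul]
  have := hG.fiberLaplacian_newtonPotential hM hα hα' hp
  rw [fiberLaplacian] at this
  rw [this, neg_mul_neg, inv_mul_cancel_left₀ (newtonConst_pos hM).ne']

/-- Existence at one degree uses uniqueness two degrees lower, so the induction carries uniqueness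
at two consecutive degrees. It starts at `-3/2` and `-1/2`, both in the range `2 - M < α < 0` once
`M ≥ 4`. -/
lemma solvable_half_integer (hM : 4 ≤ Module.finrank ℝ E) (k : ℕ) :
    HarmonicUnique E ((k : ℝ) - 1 / 2) ∧ PoissonSolvable E ((k : ℝ) - 1 / 2) := by
  have hM' : (4 : ℝ) ≤ dimE := by exact_mod_cast hM
  suffices h : HarmonicUnique E ((k : ℝ) - 3 / 2) ∧ HarmonicUnique E ((k : ℝ) - 1 / 2) ∧
      PoissonSolvable E ((k : ℝ) - 1 / 2) from h.2
  induction k with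
  | zero =>
    exact ⟨harmonicUnique_of_neg (by norm_num) (by norm_num; linarith),
      harmonicUnique_of_neg (by norm_num) (by norm_num; linarith),
      poissonSolvable_of_neg (by omega) (by norm_num) (by norm_num; linarith)⟩
  | succ k ih =>
    obtain ⟨h1, h2, h3⟩ := ih
    have hne : ((k + 1 : ℕ) : ℝ) - 1 / 2 ≠ 0 := by
      have : (0 : ℝ) ≤ k := k.cast_nonneg
      push_cast; linarith
    refine ⟨?_, HarmonicUnique.succ ?_ hne, PoissonSolvable.succ ?_ ?_ hne⟩
    · convert h2 using 1; push_cast; ring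
    · convert h2 using 1; push_cast; ring
    · convert h3 using 1; push_cast; ring
    · convert h1 using 1; push_cast; ring

end Smoothness

/-! ### Passage between the sphere and the punctured ambient space. -/

section SphereBridge

/-- The Euclidean space containing the celestial sphere. -/
abbrev AmbientSpace (d : ℕ) : Type := EuclideanSpace ℝ (Fin (d - 2 + 1))

lemma fact_finrank_ambientSpace (d : ℕ) :
    Fact (Module.finrank ℝ (AmbientSpace d) = d - 2 + 1) :=
  ⟨finrank_euclideanSpace_fin⟩

variable {d : ℕ}

lemma radialExtension_of_ne_zero (f : CelestialSphere d → ℝ) {y : AmbientSpace d} (hy : y ≠ 0) :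
    radialExtension f y = f ⟨‖y‖⁻¹ • y, inv_norm_smul_mem_sphere hy⟩ := dif_neg hy

lemma CelestialSphere.coe_ne_zero (x : CelestialSphere d) : (x : AmbientSpace d) ≠ 0 :=
  ne_zero_of_mem_sphere_one x.2

lemma CelestialSphere.norm_coe (x : CelestialSphere d) : ‖(x : AmbientSpace d)‖ = 1 :=
  mem_sphere_zero_iff_norm.mp x.2

lemma radialExtension_coe (f : CelestialSphere d → ℝ) (x : CelestialSphere d) :
    radialExtension f (x : AmbientSpace d) = f x := by
  rw [radialExtension_of_ne_zero f x.coe_ne_zero]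
  congr 1
  ext1
  simp [x.norm_coe]

/-- The extension of a function on `ℝ × S^{d-2}` which is constant along rays. -/
noncomputable def scriExtension (f : ℝ × CelestialSphere d → ℝ) (p : ℝ × AmbientSpace d) : ℝ :=
  radialExtension (fun x => f (p.1, x)) p.2

lemma scriExtension_coe (f : ℝ × CelestialSphere d → ℝ) (u : ℝ) (x : CelestialSphere d) :
    scriExtension f (u, (x : AmbientSpace d)) = f (u, x) :=
  radialExtension_coe _ x

open Classical in
/-- Radial projection to the sphere, with an arbitrary value at the origin. -/
noncomputable def radialProjection (x₀ : CelestialSphere d) (y : AmbientSpace d) :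
    CelestialSphere d :=
  if hy : y = 0 then x₀ else ⟨‖y‖⁻¹ • y, inv_norm_smul_mem_sphere hy⟩

lemma contMDiffAt_radialProjection (x₀ : CelestialSphere d) {y : AmbientSpace d} (hy : y ≠ 0) :
    ContMDiffAt 𝓘(ℝ, AmbientSpace d) (𝓡 (d - 2)) ∞ (radialProjection x₀) y := by
  let U : TopologicalSpace.Opens (AmbientSpace d) := ⟨{y | y ≠ 0}, isOpen_ne⟩
  let f : U → AmbientSpace d := fun z => ‖(z : AmbientSpace d)‖⁻¹ • (z : AmbientSpace d)
  have hf : ContMDiff 𝓘(ℝ, AmbientSpace d) 𝓘(ℝ, AmbientSpace d) ∞ f := fun z => by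
    refine (contMDiffAt_subtype_iff (U := U)
      (f := fun z : AmbientSpace d => ‖z‖⁻¹ • z)).mpr (ContDiffAt.contMDiffAt ?_)
    have hz : (z : AmbientSpace d) ≠ 0 := z.2
    exact ((contDiffAt_id.norm ℝ hz).inv (norm_ne_zero_iff.mpr hz)).smul contDiffAt_id
  have := fact_finrank_ambientSpace d
  have hcod := hf.codRestrict_sphere (n := d - 2) fun z => inv_norm_smul_mem_sphere z.2
  refine (contMDiffAt_subtype_iff (U := U) (x := ⟨y, hy⟩) (f := radialProjection x₀)).mp ?_
  refine (hcod ⟨y, hy⟩).congr_of_eventuallyEq (Filter.Eventually.of_forall fun z => ?_)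
  exact dif_neg z.2

lemma isHomog_scriExtension (f : ScriFunction d) : IsHomog 0 (scriExtension f) where
  smooth := by
    rintro ⟨u, y⟩ hy
    have hy' : y ≠ 0 := hy
    refine ContDiffAt.contDiffWithinAt ?_
    let x₀ : CelestialSphere d := ⟨_, inv_norm_smul_mem_sphere hy'⟩
    have hg : ContMDiffAt 𝓘(ℝ, ℝ × AmbientSpace d) 𝓘(ℝ, ℝ) ∞
        (fun p : ℝ × AmbientSpace d => f (p.1, radialProjection x₀ p.2)) (u, y) := by
      refine f.contMDiff.contMDiffAt.comp (u, y) ?_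
      exact contDiff_fst.contMDiff.contMDiffAt.prodMk
        ((contMDiffAt_radialProjection x₀ hy').comp (u, y) contDiff_snd.contMDiff.contMDiffAt)
    refine hg.contDiffAt.congr_of_eventuallyEq ?_
    filter_upwards [isOpen_puncturedSpace.mem_nhds hy] with p hp
    have hp' : p.2 ≠ 0 := hp
    rw [scriExtension, radialExtension_of_ne_zero _ hp', radialProjection, dif_neg hp']
  homog u y t hy ht := by
    rw [Real.rpow_zero, one_mul, scriExtension, scriExtension,
      radialExtension_of_ne_zero _ (smul_ne_zero ht.ne' hy), radialExtension_of_ne_zero _ hy]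
    congr 3
    rw [norm_smul, Real.norm_of_nonneg ht.le, mul_inv, smul_smul]
    congr 1
    field_simp

/-- Restriction to the sphere of a function smooth on the punctured space. -/
noncomputable def scriRestrict (F : ℝ × AmbientSpace d → ℝ) (hF : ContDiffOn ℝ ∞ F (puncturedSpace _)) :
    ScriFunction d :=
  ⟨fun p => F (p.1, (p.2 : AmbientSpace d)), fun p => by
    have h1 : ContMDiffAt 𝓘(ℝ, ℝ × AmbientSpace d) 𝓘(ℝ, ℝ) ∞ F (p.1, (p.2 : AmbientSpace d)) :=
      (hF.contDiffAt (isOpen_puncturedSpace.mem_nhds p.2.coe_ne_zero)).contMDiffAt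
    have := fact_finrank_ambientSpace d
    refine h1.comp p (ContMDiffAt.prodMk_space contMDiffAt_fst ?_)
    exact (contMDiff_coe_sphere (n := d - 2)).contMDiffAt.comp p contMDiffAt_snd⟩

lemma scriRestrict_apply {F : ℝ × AmbientSpace d → ℝ} (hF : ContDiffOn ℝ ∞ F (puncturedSpace _))
    (u : ℝ) (x : CelestialSphere d) : scriRestrict F hF (u, x) = F (u, (x : AmbientSpace d)) := rfl

/-- A function on the sphere, regarded as independent of retarded time. -/
noncomputable def SphereFunction.toScri (g : SphereFunction d) : ScriFunction d :=
  ⟨fun p => g p.2, g.contMDiff.comp contMDiff_snd⟩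

/-- The restriction to a fixed retarded time. -/
noncomputable def ScriFunction.atTime (f : ScriFunction d) (u : ℝ) : SphereFunction d :=
  ⟨fun x => f (u, x), f.contMDiff.comp (contMDiff_const.prodMk contMDiff_id)⟩

end SphereBridge

/-! ### Invertibility of the angular operator. -/

section AngularOperator

variable {d : ℕ}

lemma finrank_ambientSpace (hd : 2 ≤ d) : (Module.finrank ℝ (AmbientSpace d) : ℝ) = d - 1 := by
  rw [finrank_euclideanSpace_fin]
  push_cast [Nat.cast_sub hd]; ring

lemma sphereLaplacian_eq (f : ScriFunction d) (u : ℝ) (x : CelestialSphere d) :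
    sphereLaplacian (fun y => f (u, y)) x
      = fiberLaplacian (scriExtension f) (u, (x : AmbientSpace d)) :=
  laplacian_slice (stdOrthonormalBasis ℝ (AmbientSpace d)) isOpen_puncturedSpace
    (isHomog_scriExtension f).smooth (F := scriExtension f) (x := (x : AmbientSpace d))
    x.coe_ne_zero

/-- The extension of a function on `ℝ × S^{d-2}` which is homogeneous of degree `α`. -/
noncomputable def homogExtension (α : ℝ) (f : ScriFunction d) (p : ℝ × AmbientSpace d) : ℝ :=
  (‖p.2‖ ^ 2 + 0) ^ (α / 2) * scriExtension f p

lemma isHomog_homogExtension (α : ℝ) (f : ScriFunction d) : IsHomog α (homogExtension α f) := by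
  have := (IsHomog.norm_rpow (E := AmbientSpace d) α).mul (isHomog_scriExtension f)
  rwa [add_zero] at this

lemma homogExtension_coe (α : ℝ) (f : ScriFunction d) (u : ℝ) (x : CelestialSphere d) :
    homogExtension α f (u, (x : AmbientSpace d)) = f (u, x) := by
  simp [homogExtension, scriExtension_coe, x.norm_coe]

/-- On functions homogeneous of degree `α`, the Laplacian acts on the sphere as
`𝒟² + α (α + d - 3)`. -/
lemma fiberLaplacian_homogExtension (hd : 2 ≤ d) (α : ℝ) (f : ScriFunction d) (u : ℝ)
    (x : CelestialSphere d) :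
    fiberLaplacian (homogExtension α f) (u, (x : AmbientSpace d))
      = sphereLaplacian (fun y => f (u, y)) x + α * (α + d - 3) * f (u, x) := by
  set b := stdOrthonormalBasis ℝ (AmbientSpace d) with hb
  have hx := x.coe_ne_zero
  have hp : (u, (x : AmbientSpace d)) ∈ puncturedSpace (AmbientSpace d) := hx
  have hN := IsHomog.norm_rpow (E := AmbientSpace d) α
  have hf := isHomog_scriExtension f
  have h1 : fiberLaplacian (homogExtension α f) (u, (x : AmbientSpace d)) = _ :=
    sumSq_mul (fun i => ((0 : ℝ), b i)) hN.smooth hf.smooth isOpen_puncturedSpace hp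
  have h2 := fiberLaplacian_norm_rpow α hp
  rw [fiberLaplacian] at h2
  -- The cross term vanishes: the gradient of a power of the norm is radial, and a function of
  -- degree `0` has zero radial derivative.
  have h3 : ∑ i, dirDeriv ((0 : ℝ), b i) (fun p : ℝ × AmbientSpace d => (‖p.2‖ ^ 2 + 0) ^ (α / 2))
      (u, (x : AmbientSpace d)) * dirDeriv ((0 : ℝ), b i) (scriExtension f) (u, ↑x) = 0 := by
    have hpos : (0 : ℝ) < ‖(x : AmbientSpace d)‖ ^ 2 + 0 := by simp [x.norm_coe]
    have h4 : ∀ i, dirDeriv ((0 : ℝ), b i)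
        (fun p : ℝ × AmbientSpace d => (‖p.2‖ ^ 2 + 0) ^ (α / 2)) (u, (x : AmbientSpace d))
        = α * inner ℝ (x : AmbientSpace d) (b i) := fun i => by
      have := dirDeriv_radial (ContinuousLinearMap.snd ℝ ℝ (AmbientSpace d)) 0 (α / 2)
        (p := (u, (x : AmbientSpace d))) hpos ((0 : ℝ), b i)
      simp only [ContinuousLinearMap.coe_snd', x.norm_coe] at this
      rw [this]
      simp only [one_pow, add_zero, Real.one_rpow]; ring
    simp only [h4, mul_assoc]
    rw [← Finset.mul_sum, hf.euler b u hx]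
    ring
  rw [h1, h2, h3, sphereLaplacian_eq, ← fiberLaplacian.eq_1, scriExtension_coe,
    finrank_ambientSpace hd]
  simp only [x.norm_coe, one_pow, add_zero, Real.one_rpow]
  ring

/-- Unique solvability of the angular equation with smooth dependence on retarded time. -/
def AngularSolvable (d : ℕ) (n : ℚ) : Prop :=
  ∀ g : ScriFunction d, ∃! f : ScriFunction d,
    ∀ u x, angularOperator d n (fun y => f (u, y)) x = g (u, x)

/-- Homogeneous extension and restriction to the sphere are mutually inverse and turn the angular
operator into the Laplacian, so existence and uniqueness transfer directly. -/
lemma angularSolvable_of_poissonSolvable (hd : 2 ≤ d) {n : ℚ} {α : ℝ}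
    (hn : (((n - 1) * (n - d + 2) : ℚ) : ℝ) = α * (α + d - 3))
    (hu : HarmonicUnique (AmbientSpace d) α) (hs : PoissonSolvable (AmbientSpace d) α) :
    AngularSolvable d n := by
  intro g
  have hop : ∀ (f : ScriFunction d) u x, angularOperator d n (fun y => f (u, y)) x
      = fiberLaplacian (homogExtension α f) (u, (x : AmbientSpace d)) := fun f u x => by
    rw [fiberLaplacian_homogExtension hd, angularOperator, hn]
  have hext : ∀ {F G : ℝ × AmbientSpace d → ℝ} {β : ℝ}, IsHomog β F → IsHomog β G →
      (∀ u (x : CelestialSphere d), F (u, (x : AmbientSpace d)) = G (u, (x : AmbientSpace d))) →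
      Set.EqOn F G (puncturedSpace _) := fun hF hG h p hp => by
    have hp' : p.2 ≠ 0 := hp
    have := h p.1 ⟨_, inv_norm_smul_mem_sphere hp'⟩
    rw [← Prod.mk.eta (p := p), hF.eq_norm_rpow_mul p.1 hp', hG.eq_norm_rpow_mul p.1 hp', this]
  obtain ⟨F, hF, hFG⟩ := hs _ (isHomog_homogExtension (α - 2) g)
  refine ⟨scriRestrict F hF.smooth, fun u x => ?_, fun f' hf' => ?_⟩
  · have heq := hext (isHomog_homogExtension α (scriRestrict F hF.smooth)) hF fun u x => by
      rw [homogExtension_coe, scriRestrict_apply]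
    rw [hop]
    have := sumSq_congr (fun i => ((0 : ℝ), stdOrthonormalBasis ℝ (AmbientSpace d) i))
      isOpen_puncturedSpace heq (x := (u, (x : AmbientSpace d))) x.coe_ne_zero
    rw [← fiberLaplacian.eq_1, ← fiberLaplacian.eq_1] at this
    rw [this, hFG _ x.coe_ne_zero, homogExtension_coe]
  · have hH' := isHomog_homogExtension α f'
    have hlap : ∀ p ∈ puncturedSpace (AmbientSpace d),
        fiberLaplacian (homogExtension α f') p = homogExtension (α - 2) g p :=
      hext hH'.isHomog_fiberLaplacian (isHomog_homogExtension (α - 2) g) fun u x => by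
        rw [← hop, hf', homogExtension_coe]
    have h0 := hu _ (hH'.sub hF) fun p hp => by
      have := sumSq_sub (fun i => ((0 : ℝ), stdOrthonormalBasis ℝ (AmbientSpace d) i))
        hH'.smooth hF.smooth isOpen_puncturedSpace hp
      rw [← fiberLaplacian.eq_1, ← fiberLaplacian.eq_1, ← fiberLaplacian.eq_1] at this
      rw [this, hlap p hp, hFG p hp, sub_self]
    ext ⟨u, x⟩
    have := h0 (u, (x : AmbientSpace d)) x.coe_ne_zero
    rw [homogExtension_coe] at this
    rw [scriRestrict_apply]
    linarith

lemma AngularSolvable.invertible {n : ℚ} (h : AngularSolvable d n) :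
    AngularOperatorInvertible d n := by
  intro g
  obtain ⟨f, hf, huniq⟩ := h g.toScri
  refine ⟨f.atTime 0, fun x => hf 0 x, fun f' hf' => ?_⟩
  have := huniq f'.toScri fun u x => hf' x
  rw [← this]
  rfl

lemma three_le_finrank (hd : 4 ≤ d) : 3 ≤ Module.finrank ℝ (AmbientSpace d) := by
  rw [finrank_euclideanSpace_fin]; omega

/-- Between the radiative and Coulombic orders, the angular operator is invertible. -/
lemma angularSolvable_of_mem_Ioo (hd : 4 ≤ d) {n : ℚ} (h1 : 1 < n) (h2 : n < d - 2) :
    AngularSolvable d n := by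
  have h1' : (1 : ℝ) < n := by exact_mod_cast h1
  have h2' : (n : ℝ) < d - 2 := by exact_mod_cast h2
  have hr := finrank_ambientSpace (d := d) (by omega)
  refine angularSolvable_of_poissonSolvable (α := 1 - n) (by omega) (by push_cast; ring)
    (harmonicUnique_of_neg (by linarith) (by rw [hr]; linarith))
    (poissonSolvable_of_neg (three_le_finrank hd) (by linarith) (by rw [hr]; linarith))

/-- Of the two admissible degrees `1 - n` and `n - d + 2`, whose sum is `3 - d`, the first is used
for `n ≤ 1/2` and the second for `n ≥ d - 5/2`. Each is then of the form `m - 1/2` with `m` natural.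
The orders in between lie in the range of the maximum principle. -/
lemma angularSolvable_half_integer (hd : 5 ≤ d) (k : ℤ) :
    AngularSolvable d ((k : ℚ) + 1 / 2) := by
  have hM : 4 ≤ Module.finrank ℝ (AmbientSpace d) := by rw [finrank_euclideanSpace_fin]; omega
  rcases le_or_gt k 0 with hk | hk
  · obtain ⟨m, hm⟩ : ∃ m : ℕ, (m : ℤ) = 1 - k := ⟨(1 - k).toNat, by omega⟩
    have hm' : (m : ℝ) = 1 - k := by exact_mod_cast hm
    obtain ⟨hu, hs⟩ := solvable_half_integer hM m
    refine angularSolvable_of_poissonSolvable (by omega) ?_ hu hs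
    rw [hm']; push_cast; ring
  have hk1 : (1 : ℚ) ≤ k := by exact_mod_cast hk
  rcases lt_or_ge k (d - 3) with hk2 | hk2
  · have hk3 : (k : ℚ) + 1 ≤ d - 3 := by exact_mod_cast hk2
    exact angularSolvable_of_mem_Ioo (by omega) (by linarith) (by linarith)
  · obtain ⟨m, hm⟩ : ∃ m : ℕ, (m : ℤ) = k - d + 3 := ⟨(k - d + 3).toNat, by omega⟩
    have hm' : (m : ℝ) = k - d + 3 := by exact_mod_cast hm
    obtain ⟨hu, hs⟩ := solvable_half_integer hM m
    refine angularSolvable_of_poissonSolvable (by omega) ?_ hu hs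
    rw [hm']; push_cast; ring

end AngularOperator

/-! ### Primitives in retarded time. -/

section TimeIntegration

variable {E : Type} [NormedAddCommGroup E] [InnerProductSpace ℝ E]

/-- The primitive in the first variable which vanishes at `u₀`. -/
noncomputable def timeIntegral (u₀ : ℝ) (H : ℝ × E → ℝ) (p : ℝ × E) : ℝ :=
  ∫ s in u₀..p.1, H (s, p.2)

/-- The substitution `s = u₀ + (u - u₀) t` turns the moving endpoint into a parameter of an integral
over `[0, 1]`. -/
lemma contDiffOn_timeIntegral (u₀ : ℝ) {H : ℝ × E → ℝ}
    (hH : ContDiffOn ℝ ∞ H (puncturedSpace E)) :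
    ContDiffOn ℝ ∞ (timeIntegral u₀ H) (puncturedSpace E) := by
  set W : Set ((ℝ × E) × ℝ) := {q | q.1.2 ≠ 0} with hW
  have hWo : IsOpen W := isOpen_ne.preimage (by fun_prop)
  have hΨ : ContDiffOn ℝ ∞ (fun q : (ℝ × E) × ℝ => H (u₀ + (q.1.1 - u₀) * q.2, q.1.2)) W := by
    refine hH.comp (t := puncturedSpace E) (ContDiff.contDiffOn ?_) fun q hq => hq
    fun_prop
  have h1 := contDiffOn_setIntegral_of_isCompact (μ := volume) (isCompact_Icc (a := (0 : ℝ)) (b := 1))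
    hWo (by simp) hΨ
  have h2 : ContDiffOn ℝ ∞ (fun p : ℝ × E => p.1 - u₀) (puncturedSpace E) :=
    (contDiff_fst.sub contDiff_const).contDiffOn
  refine (h2.mul (h1.mono fun p hp q _ => hp)).congr fun p hp => ?_
  have := intervalIntegral.mul_integral_comp_add_mul (a := 0) (b := 1) (f := fun s => H (s, p.2))
    (c := p.1 - u₀) (d := u₀)
  rw [intervalIntegral.integral_of_le zero_le_one, ← integral_Icc_eq_integral_Ioc] at this
  rw [this, timeIntegral]
  simp

lemma deriv_timeIntegral (u₀ : ℝ) {H : ℝ × E → ℝ} (hH : ContDiffOn ℝ ∞ H (puncturedSpace E))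
    (u : ℝ) {y : E} (hy : y ≠ 0) : HasDerivAt (fun v => timeIntegral u₀ H (v, y)) (H (u, y)) u := by
  have hc : Continuous fun s => H (s, y) :=
    continuousOn_univ.mp (hH.continuousOn.comp (by fun_prop) fun _ _ => hy)
  exact intervalIntegral.integral_hasDerivAt_right (hc.intervalIntegrable _ _)
    hc.stronglyMeasurable.stronglyMeasurableAtFilter hc.continuousAt

end TimeIntegration

/-! ### Solving one recursion step in either direction. -/

section RecursionStep

variable {d : ℕ}

/-- The recursion relation between two consecutive coefficients. -/
def RecursionStep (n : ℚ) (prev next src : ScriFunction d) : Prop :=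
  ∀ (u : ℝ) (x : CelestialSphere d), angularOperator d n (fun y => prev (u, y)) x
    + ((2 * n - d + 2 : ℚ) : ℝ) * deriv (fun v : ℝ => next (v, x)) u = src (u, x)

lemma recursionAt_iff {φ S : ℚ → ScriFunction d} {n : ℚ} :
    RecursionAt φ S n ↔ RecursionStep n (φ (n - 1)) (φ n) (S (n + 1)) := Iff.rfl

lemma ScriFunction.differentiable_slice (f : ScriFunction d) (x : CelestialSphere d) :
    Differentiable ℝ fun v => f (v, x) := fun u => by
  have h := (isHomog_scriExtension f).differentiableAt (u := u) x.coe_ne_zero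
  have h2 : DifferentiableAt ℝ (fun v : ℝ => (v, (x : AmbientSpace d))) u := by fun_prop
  have h3 := DifferentiableAt.comp u h h2
  refine h3.congr_of_eventuallyEq (Filter.Eventually.of_forall fun v => ?_)
  exact (scriExtension_coe f v x).symm

/-- The coefficient of lower order is determined by the one of higher order where the angular
operator is invertible. -/
lemma AngularSolvable.existsUnique_prev {n : ℚ} (h : AngularSolvable d n)
    (next src : ScriFunction d) : ∃! prev, RecursionStep n prev next src := by
  set κ : ℝ := ((2 * n - d + 2 : ℚ) : ℝ) with hκ
  have hH := (isHomog_scriExtension src).sub ((isHomog_scriExtension next).dirDeriv_fst.const_mul κ)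
  have hval : ∀ u x, scriRestrict _ hH.smooth (u, x)
      = src (u, x) - κ * deriv (fun v => next (v, x)) u := fun u x => by
    rw [scriRestrict_apply, scriExtension_coe,
      ← deriv_slice ((isHomog_scriExtension next).differentiableAt x.coe_ne_zero)]
    simp only [scriExtension_coe]
  refine (existsUnique_congr fun prev => ?_).mp (h (scriRestrict _ hH.smooth))
  refine forall₂_congr fun u x => ?_
  rw [hval, eq_sub_iff_add_eq]

/-- The coefficient of higher order is determined by the one of lower order and initial data. -/
lemma existsUnique_next {n : ℚ} (hn : 2 * n - d + 2 ≠ 0) (prev src : ScriFunction d) (u₀ : ℝ)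
    (init : SphereFunction d) :
    ∃! next, RecursionStep n prev next src ∧ ∀ x, next (u₀, x) = init x := by
  set κ : ℝ := ((2 * n - d + 2 : ℚ) : ℝ) with hκ
  have hκ0 : κ ≠ 0 := by rw [hκ]; exact_mod_cast hn
  set c : ℝ := (((n - 1) * (n - d + 2) : ℚ) : ℝ) with hc
  have hP := isHomog_scriExtension prev
  set H : ℝ × AmbientSpace d → ℝ := fun p => κ⁻¹ * (scriExtension src p
    - (fiberLaplacian (scriExtension prev) p + c * scriExtension prev p)) with hHdef
  have hH : ContDiffOn ℝ ∞ H (puncturedSpace _) :=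
    contDiffOn_const.mul ((isHomog_scriExtension src).smooth.sub
      (hP.isHomog_fiberLaplacian.smooth.add (contDiffOn_const.mul hP.smooth)))
  have hHval : ∀ u (x : CelestialSphere d), H (u, (x : AmbientSpace d))
      = κ⁻¹ * (src (u, x) - angularOperator d n (fun y => prev (u, y)) x) := fun u x => by
    rw [hHdef, angularOperator, sphereLaplacian_eq]
    simp only [scriExtension_coe, hc]
  have hF : ContDiffOn ℝ ∞ (fun p => scriExtension init.toScri p + timeIntegral u₀ H p)
      (puncturedSpace _) :=
    (isHomog_scriExtension _).smooth.add (contDiffOn_timeIntegral u₀ hH)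
  have hFval : ∀ u x, scriRestrict _ hF (u, x)
      = init x + timeIntegral u₀ H (u, (x : AmbientSpace d)) := fun u x => by
    rw [scriRestrict_apply, scriExtension_coe]; rfl
  have hder : ∀ next : ScriFunction d, RecursionStep n prev next src ↔
      ∀ u (x : CelestialSphere d), deriv (fun v => next (v, x)) u = H (u, (x : AmbientSpace d)) := by
    refine fun next => forall₂_congr fun u x => ?_
    rw [hHval, eq_inv_mul_iff_mul_eq₀ hκ0, eq_sub_iff_add_eq, add_comm]
  have hFder : ∀ u (x : CelestialSphere d),
      HasDerivAt (fun v => scriRestrict _ hF (v, x)) (H (u, (x : AmbientSpace d))) u := fun u x => by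
    simp only [hFval]
    exact (deriv_timeIntegral u₀ hH u x.coe_ne_zero).const_add (init x)
  refine ⟨scriRestrict _ hF, ⟨(hder _).mpr fun u x => (hFder u x).deriv, fun x => ?_⟩, ?_⟩
  · rw [hFval, timeIntegral, intervalIntegral.integral_same, add_zero]
  · rintro next ⟨h1, h2⟩
    ext ⟨u, x⟩
    have h3 : Differentiable ℝ fun v => next (v, x) - scriRestrict _ hF (v, x) :=
      (next.differentiable_slice x).sub ((scriRestrict _ hF).differentiable_slice x)
    have h4 := is_const_of_deriv_eq_zero h3 (fun v => by
      rw [deriv_fun_sub (next.differentiable_slice x v)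
        ((scriRestrict _ hF).differentiable_slice x v), (hder next).mp h1, (hFder v x).deriv,
        sub_self]) u u₀
    simp only [h2] at h4
    rw [hFval u₀, timeIntegral, intervalIntegral.integral_same, add_zero, sub_self] at h4
    exact sub_eq_zero.mp h4

lemma angularOperator_zero (n : ℚ) (u : ℝ) (x : CelestialSphere d) :
    angularOperator d n (fun y => (0 : ScriFunction d) (u, y)) x = 0 := by
  have : radialExtension (fun _ : CelestialSphere d => (0 : ℝ)) = fun _ => 0 := by
    ext y; simp [radialExtension]
  have h0 : (fun y => (0 : ScriFunction d) (u, y)) = fun _ => (0 : ℝ) := rfl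
  rw [angularOperator, h0, sphereLaplacian, this]
  simp

end RecursionStep

/-! ### Two-sided recursive construction of sequences. -/

section Sequences

/-- A sequence is determined by its term at `j₀` if each step can be solved uniquely for the
lower term below `j₀`, and for the higher term, subject to a side condition, above `j₀`. -/
lemma existsUnique_sequence {X : Type*} (R : ℕ → X → X → Prop) (I : ℕ → X → Prop) (j₀ : ℕ) (ψ : X)
    (down : ∀ j < j₀, ∀ next, ∃! prev, R j prev next)
    (up : ∀ j, j₀ ≤ j → ∀ prev, ∃! next, R j prev next ∧ I (j + 1) next) :
    ∃! a : ℕ → X, (∀ j, R j (a j) (a (j + 1))) ∧ a j₀ = ψ ∧ ∀ j, j₀ < j → I j (a j) := by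
  -- At `j₀ = 0` the upward steps are iterated. Otherwise the tail from index `1` is determined by
  -- induction, and the first downward step supplies the term at `0`.
  induction j₀ generalizing R I with
  | zero =>
    choose U hU hU' using fun j prev => up j (Nat.zero_le j) prev
    refine ⟨fun j => Nat.rec ψ U j, ⟨fun j => (hU j _).1, rfl, fun j hj => ?_⟩, ?_⟩
    · obtain ⟨i, rfl⟩ := Nat.exists_eq_succ_of_ne_zero hj.ne'
      exact (hU i _).2
    · rintro a ⟨h1, h2, h3⟩
      ext j
      induction j with
      | zero => exact h2
      | succ j ih =>
        have := hU' j (a j) (a (j + 1)) ⟨h1 j, h3 _ (Nat.succ_pos j)⟩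
        rw [this, ih]
  | succ j₀ ih =>
    obtain ⟨a, ⟨h1, h2, h3⟩, huniq⟩ := ih (fun j => R (j + 1)) (fun j => I (j + 1))
      (fun j hj => down _ (by omega)) (fun j hj => up _ (by omega))
    obtain ⟨p, hp, hp'⟩ := down 0 (Nat.succ_pos _) (a 0)
    refine ⟨fun j => Nat.casesOn j p a, ⟨fun j => ?_, h2, fun j hj => ?_⟩, ?_⟩
    · cases j with
      | zero => exact hp
      | succ j => exact h1 j
    · cases j with
      | zero => omega
      | succ j => exact h3 j (by omega)
    · rintro b ⟨g1, g2, g3⟩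
      have hb := huniq (fun j => b (j + 1))
        ⟨fun j => g1 (j + 1), g2, fun j hj => g3 _ (by omega)⟩
      ext j
      cases j with
      | zero => exact hp' _ (by have := g1 0; rwa [congrFun hb 0] at this)
      | succ j => exact congrFun hb j

/-- Families supported on `β + ℕ` correspond to sequences. -/
lemma existsUnique_of_sequence {X : Type*} [Zero X] (β : ℚ) {P : (ℕ → X) → Prop}
    (h : ∃! a, P a) :
    ∃! φ : ℚ → X, (∀ n, (¬∃ j : ℕ, n = β + j) → φ n = 0) ∧ P fun j => φ (β + j) := by
  classical
  obtain ⟨a, ha, huniq⟩ := h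
  have hval : ∀ j : ℕ, (if h : ∃ i : ℕ, β + j = β + i then a h.choose else 0) = a j := fun j => by
    have hex : ∃ i : ℕ, β + (j : ℚ) = β + i := ⟨j, rfl⟩
    rw [dif_pos hex]
    have := hex.choose_spec
    congr 1
    exact_mod_cast (add_left_cancel this).symm
  refine ⟨fun n => if h : ∃ i : ℕ, n = β + i then a h.choose else 0,
    ⟨fun n hn => dif_neg hn, ?_⟩, ?_⟩
  · simp only [hval]; exact ha
  · rintro φ ⟨h1, h2⟩
    ext n
    by_cases hn : ∃ i : ℕ, n = β + i
    · obtain ⟨i, rfl⟩ := hn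
      exact (congrFun (huniq _ h2) i).trans (hval i).symm
    · rw [h1 n hn, dif_neg hn]

end Sequences

/-! ### The recursions on full expansions. -/

section Expansions

variable {d : ℕ}

lemma recursionAt_succ_iff {φ S : ℚ → ScriFunction d} {β : ℚ} {j : ℕ} :
    RecursionAt φ S (β + (j + 1 : ℕ)) ↔
      RecursionStep (β + j + 1) (φ (β + j)) (φ (β + (j + 1 : ℕ))) (S (β + j + 2)) := by
  have h1 : β + ((j + 1 : ℕ) : ℚ) = β + j + 1 := by push_cast; ring
  rw [recursionAt_iff, h1, show β + (j : ℚ) + 1 - 1 = β + j by ring,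
    show β + (j : ℚ) + 1 + 1 = β + j + 2 by ring]

/-- The recursion on an expansion starting at radiative order is uniquely solved by prescribing
one coefficient, and initial data above it. -/
lemma existsUnique_radiative (σ : ℚ → ScriFunction d) (hσ : σ ((d : ℚ) / 2) = 0)
    (j₀ : ℕ) (hang : ∀ j < j₀, AngularSolvable d ((d : ℚ) / 2 - 1 + j + 1)) (u₀ : ℝ)
    {n₀ : ℚ} (hn₀ : n₀ = (d : ℚ) / 2 - 1 + j₀)
    (ψ : ScriFunction d) (φ₀ : ℚ → SphereFunction d) :
    ∃! φ : ℚ → ScriFunction d,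
      IsExpansion (radiativeOrders d) φ ∧
      (∀ n ∈ radiativeOrders d, RecursionAt φ σ n) ∧
      φ n₀ = ψ ∧
      (∀ n ∈ radiativeOrders d, n₀ < n → ∀ x, φ n (u₀, x) = φ₀ n x) := by
  subst hn₀
  set β : ℚ := (d : ℚ) / 2 - 1 with hβ
  have hseq := existsUnique_sequence
    (fun j (p q : ScriFunction d) => RecursionStep (β + j + 1) p q (σ (β + j + 2)))
    (fun j (q : ScriFunction d) => ∀ x, q (u₀, x) = φ₀ (β + j) x) j₀ ψ
    (fun j hj next => (hang j hj).existsUnique_prev next _)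
    (fun j _ prev => existsUnique_next (by
      have : (0 : ℚ) ≤ j := j.cast_nonneg
      rw [hβ]; linarith) prev _ u₀ _)
  refine (existsUnique_congr fun φ => ?_).mp (existsUnique_of_sequence β hseq)
  refine and_congr_right fun hφ => and_congr ?_ (and_congr Iff.rfl ?_)
  · refine ⟨fun h n hn => ?_, fun h j => recursionAt_succ_iff.mp (h _ ⟨j + 1, rfl⟩)⟩
    obtain ⟨j, rfl⟩ := hn
    cases j with
    -- At radiative order the previous coefficient lies outside the expansion and the factor of
    -- `∂_u` is zero, so the equation holds precisely because the source vanishes there.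
    | zero =>
      have hprev : φ (β + (0 : ℕ) - 1) = 0 := hφ _ fun ⟨i, hi⟩ => by
        have : (0 : ℚ) ≤ i := i.cast_nonneg
        push_cast at hi; linarith
      have hsrc : σ (β + (0 : ℕ) + 1) = 0 := by
        rw [show β + (0 : ℕ) + 1 = (d : ℚ) / 2 by rw [hβ]; push_cast; ring, hσ]
      have hcoef : 2 * (β + (0 : ℕ)) - d + 2 = 0 := by rw [hβ]; push_cast; ring
      intro u x
      rw [← hβ, hprev, hsrc, hcoef, angularOperator_zero]
      simp
    | succ j => exact recursionAt_succ_iff.mpr (h j)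
  · refine ⟨fun h n hn hlt => ?_, fun h j hj => h _ ⟨j, rfl⟩ (by
      have : (j₀ : ℚ) < j := by exact_mod_cast hj
      linarith)⟩
    obtain ⟨j, rfl⟩ := hn
    exact h j (by
      have : (j₀ : ℚ) < j := by linarith
      exact_mod_cast this)

/-- The recursion on an expansion starting at Coulombic order is uniquely solved by prescribing
initial data. -/
lemma existsUnique_coulombic (hd : 5 ≤ d) (S : ℚ → ScriFunction d) (u₀ : ℝ)
    (φ₀ : ℚ → SphereFunction d) :
    ∃! φ : ℚ → ScriFunction d,
      IsExpansion (coulombicOrders d) φ ∧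
      (∀ p ∈ coulombicOrders d, RecursionAt φ S p) ∧
      (∀ p ∈ coulombicOrders d, ∀ x, φ p (u₀, x) = φ₀ p x) := by
  have hd' : (5 : ℚ) ≤ d := by exact_mod_cast hd
  -- Indexing starts one order below Coulombic, with the term there prescribed to be `0`. The
  -- equation at `p = d - 3` then becomes an ordinary upward step, with factor `d - 4 ≠ 0`.
  set β : ℚ := (d : ℚ) - 4 with hβ
  have hseq := existsUnique_sequence
    (fun j (p q : ScriFunction d) => RecursionStep (β + j + 1) p q (S (β + j + 2)))
    (fun j (q : ScriFunction d) => ∀ x, q (u₀, x) = φ₀ (β + j) x) 0 0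
    (fun j hj => absurd hj (Nat.not_lt_zero j))
    (fun j _ prev => existsUnique_next (by
      have : (0 : ℚ) ≤ j := j.cast_nonneg
      rw [hβ]; linarith) prev _ u₀ _)
  have hmem : ∀ p : ℚ, p ∈ coulombicOrders d ↔ ∃ j : ℕ, p = β + (j + 1 : ℕ) := fun p =>
    exists_congr fun j => by
      rw [show β + ((j + 1 : ℕ) : ℚ) = (d : ℚ) - 3 + j by rw [hβ]; push_cast; ring]
  refine (existsUnique_congr fun φ => ?_).mp (existsUnique_of_sequence β hseq)
  constructor
  · rintro ⟨h0, h1, h2, h3⟩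
    refine ⟨fun n hn => ?_, fun n hn => ?_, fun n hn => ?_⟩
    · by_cases hn' : ∃ j : ℕ, n = β + j
      · obtain ⟨j, rfl⟩ := hn'
        cases j with
        | zero => exact h2
        | succ j => exact absurd ((hmem _).mpr ⟨j, rfl⟩) hn
      · exact h0 n hn'
    · obtain ⟨j, rfl⟩ := (hmem n).mp hn
      exact recursionAt_succ_iff.mpr (h1 j)
    · obtain ⟨j, rfl⟩ := (hmem n).mp hn
      exact h3 _ (Nat.succ_pos j)
  · rintro ⟨h0, h1, h2⟩
    refine ⟨fun n hn => h0 n fun hm => ?_, fun j => ?_, h0 _ fun hm => ?_, fun j hj => ?_⟩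
    · obtain ⟨j, hj⟩ := (hmem n).mp hm
      exact hn ⟨_, hj⟩
    · exact recursionAt_succ_iff.mp (h1 _ ((hmem _).mpr ⟨j, rfl⟩))
    · obtain ⟨j, hj⟩ := (hmem _).mp hm
      have : (0 : ℚ) ≤ j := j.cast_nonneg
      push_cast at hj; linarith
    · obtain ⟨i, rfl⟩ := Nat.exists_eq_succ_of_ne_zero hj.ne'
      exact h2 _ ((hmem _).mpr ⟨i, rfl⟩)

end Expansions

theorem mainTheorem9 (d : ℕ) (hd : 4 ≤ d)
    (S : ℚ → ScriFunction d) (hS : IsExpansion (sourceOrders d) S)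
    (hS4 : d = 4 → S 2 = 0) (u₀ : ℝ) :
    (Even d →
      (∀ n : ℤ, 1 < n → n ≤ (d : ℤ) - 3 → AngularOperatorInvertible d n) ∧
      (∀ (φC : ScriFunction d) (φ₀ : ℚ → SphereFunction d),
        ∃! φ : ℚ → ScriFunction d,
          IsExpansion (radiativeOrders d) φ ∧
          (∀ n ∈ radiativeOrders d, RecursionAt φ S n) ∧
          φ ((d : ℚ) - 3) = φC ∧
          (∀ n ∈ radiativeOrders d, (d : ℚ) - 3 < n → ∀ x, φ n (u₀, x) = φ₀ n x))) ∧
    (Odd d →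
      (∀ k : ℤ, AngularOperatorInvertible d ((k : ℚ) + 1 / 2)) ∧
      (∀ n₀ : ℚ, (∃ k : ℤ, n₀ = (k : ℚ) + 1 / 2) → (d : ℚ) / 2 - 1 ≤ n₀ →
        ∀ (φn₀ : ScriFunction d) (φ₀ φt₀ : ℚ → SphereFunction d),
        ∃! Φ : (ℚ → ScriFunction d) × (ℚ → ScriFunction d),
          IsExpansion (radiativeOrders d) Φ.1 ∧
          IsExpansion (coulombicOrders d) Φ.2 ∧
          (∀ n ∈ radiativeOrders d, RecursionAt Φ.1 0 n) ∧
          (∀ p ∈ coulombicOrders d, RecursionAt Φ.2 S p) ∧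
          Φ.1 n₀ = φn₀ ∧
          (∀ n ∈ radiativeOrders d, n₀ < n → ∀ x, Φ.1 n (u₀, x) = φ₀ n x) ∧
          (∀ p ∈ coulombicOrders d, ∀ x, Φ.2 p (u₀, x) = φt₀ p x))) := by
  have hd' : (4 : ℚ) ≤ d := by exact_mod_cast hd
  refine ⟨fun heven => ⟨fun n h1 h2 => ?_, fun φC φ₀ => ?_⟩,
    fun hodd => ⟨fun k => ?_, fun n₀ hn₀ hle φn₀ φ₀ φt₀ => ?_⟩⟩
  · have h1' : (1 : ℚ) < n := by exact_mod_cast h1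
    have h2' : (n : ℚ) ≤ d - 3 := by exact_mod_cast h2
    exact (angularSolvable_of_mem_Ioo hd h1' (by linarith)).invertible
  · obtain ⟨m, hm⟩ := heven
    have hm' : (d : ℚ) = m + m := by exact_mod_cast hm
    have hcast : ((m - 2 : ℕ) : ℚ) = m - 2 := by
      rw [Nat.cast_sub (by omega)]; norm_num
    -- For `d > 4` the order `d/2` lies below the first source order `d - 2`. For `d = 4` the two
    -- coincide and the extra hypothesis is used.
    have hσ : S ((d : ℚ) / 2) = 0 := by
      rcases hd.eq_or_lt with h4 | h4
      · have h2 : (d : ℚ) / 2 = 2 := by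
          have : (4 : ℚ) = d := by exact_mod_cast h4
          rw [← this]; norm_num
        rw [h2, hS4 h4.symm]
      · refine hS _ fun ⟨j, hj⟩ => ?_
        have : (0 : ℚ) ≤ j := j.cast_nonneg
        have : (4 : ℚ) < d := by exact_mod_cast h4
        linarith
    -- With `d = 2m`, Coulombic order lies `m - 2` steps above radiative order. The downward steps
    -- involve only orders between `d/2` and `d - 3`.
    refine existsUnique_radiative S hσ (m - 2) (fun j hj => ?_) u₀
      (by rw [hcast]; linarith) φC φ₀
    have hj' : (j : ℚ) + 1 ≤ m - 2 := by rw [← hcast]; exact_mod_cast hj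
    have : (0 : ℚ) ≤ j := j.cast_nonneg
    exact angularSolvable_of_mem_Ioo hd (by linarith) (by linarith)
  · have h5 : 5 ≤ d := by obtain ⟨r, hr⟩ := hodd; omega
    exact (angularSolvable_half_integer h5 k).invertible
  · obtain ⟨r, hr⟩ := hodd
    have h5 : 5 ≤ d := by omega
    have hr' : (d : ℚ) = 2 * r + 1 := by exact_mod_cast hr
    obtain ⟨k, rfl⟩ := hn₀
    have hk : (r : ℤ) - 1 ≤ k := by
      have : (r : ℚ) - 1 ≤ k := by linarith
      exact_mod_cast this
    -- With `d = 2r + 1`, radiative order is `r - 1/2`, so `k + 1/2` lies `k + 1 - r` steps above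
    -- it.
    obtain ⟨j₀, hj₀⟩ : ∃ j₀ : ℕ, (j₀ : ℤ) = k + 1 - r := ⟨(k + 1 - r).toNat, by omega⟩
    have hj₀' : (j₀ : ℚ) = k + 1 - r := by exact_mod_cast hj₀
    obtain ⟨φ, ⟨a1, a2, a3, a4⟩, hφ⟩ := existsUnique_radiative 0 rfl j₀ (fun j _ => by
        have := angularSolvable_half_integer h5 ((r : ℤ) + j)
        convert this using 1
        rw [hr']; push_cast; ring) u₀ (n₀ := (k : ℚ) + 1 / 2)
      (by rw [hj₀']; linarith) φn₀ φ₀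
    -- The half-integer and integer recursions share no coefficient, and the source enters only the
    -- second, so the two unique solutions simply pair up.
    obtain ⟨φt, ⟨b1, b2, b3⟩, hφt⟩ := existsUnique_coulombic h5 S u₀ φt₀
    refine ⟨(φ, φt), ⟨a1, b1, a2, b2, a3, a4, b3⟩, ?_⟩
    rintro ⟨χ, χt⟩ ⟨c1, e1, c2, e2, c3, c4, e3⟩
    exact Prod.ext (hφ χ ⟨c1, c2, c3, c4⟩) (hφt χt ⟨e1, e2, e3⟩)
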